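/- **Setting.** For $d\in\mathbb N$ let $\mathscr H_d$ be the space of real symmetric $d\times d$ matrices with inner product $\langle X,Y\rangle=\operatorname{trace}(XY^*)$. Fix $k\ge 1$ and real numbers $1\ge\lambda_1\ge\dots\ge\lambda_k>0$. For $d>k$ let $D_\lambda=\operatorname{diag}(\lambda_1,\dots,\lambda_k,0,\dots,0)\in\mathscr H_d$, let $$\mathcal G_{\lambda,d}=\{OD_\lambda O^* : O\in\mathcal O(d)\}$$ (the positive semidefinite matrices of rank $k$ with nonzero eigenvalues $\lambda_1,\dots,\lambda_k$), and let $\sigma_{\lambda,d}$ be the image of the normalized Haar measure of the orthogonal group $\mathcal O(d)$ under $O\mapsto OD_\lambda O^*$. A $\mathcal G_{\lambda,d}$-valued random matrix $\mathcal P$ is a *random cubature of strength $t$* if $$\mathbb E\big(\langle\mathcal P,X\rangle^t\big)=\int_{\mathcal G_{\lambda,d}}\langle P,X\rangle^t\,d\sigma_{\lambda,d}(P)$$ for all $X\in\mathscr H_d$, and a *random tight $t$-fusion frame* if this holds for all $X=xx^*$ with $x\in\mathbb R^d$. **Theorem.** There is a constant $c_1>0$, depending only on $k$ and $\lambda_1,\dots,\lambda_k$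 (in particular not on $d$), such that the following holds for every $d>k$, every $x\in\mathbb R^d$, every integer $t\ge 3$, every real $\omega\ge 1$, and every random matrix $\mathcal P\in\mathcal G_{\lambda,d}$ that is a random cubature of strength $3$ and also a random tight $t$-fusion frame. If $$n\ge c_1\,\omega\,t\,d^{1+2/t}\log^2(d)$$ and $\mathcal P_1,\dots,\mathcal P_n$ are independent random matrices, each with the same distribution as $\mathcal P$, then with probability at least $1-e^{-\omega}$ the matrix $X=xx^*$ is the unique solution of the feasibility problem $$\text{find } X\in\mathscr H_d\ \text{ such that }\ X\succeq 0,\quad \operatorname{trace}(X)=\|x\|^2,\quad \langle X,\mathcal P_j\rangle=\langle xx^*,\mathcal P_j\rangle\ \ (j=1,\dots,n).$$ -/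

import Mathlib

open MeasureTheory ProbabilityTheory

namespace PhaseRetrieval

/-- Real `d × d` matrices carry the entrywise product sigma-algebra, which is the Borel one. -/
instance instMeasurableSpaceMatrix (d : ℕ) : MeasurableSpace (Matrix (Fin d) (Fin d) ℝ) :=
  inferInstanceAs (MeasurableSpace (Fin d → Fin d → ℝ))

instance instBorelSpaceMatrix (d : ℕ) : BorelSpace (Matrix (Fin d) (Fin d) ℝ) :=
  inferInstanceAs (BorelSpace (Fin d → Fin d → ℝ))

/-- The orthogonal group `O(d)` is compact (closed, with entries bounded by `1`). -/
instance instCompactSpaceOrthogonal (d : ℕ) :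
    CompactSpace (Matrix.orthogonalGroup (Fin d) ℝ) := by
  have hK : IsCompact (Set.pi Set.univ fun _ : Fin d =>
      Set.pi Set.univ fun _ : Fin d => Set.Icc (-1 : ℝ) 1) :=
    isCompact_univ_pi fun _ => isCompact_univ_pi fun _ => isCompact_Icc
  have hcl : IsClosed {U : Matrix (Fin d) (Fin d) ℝ | star U * U = 1} :=
    isClosed_eq (by fun_prop) continuous_const
  have hset : (Matrix.orthogonalGroup (Fin d) ℝ : Set (Matrix (Fin d) (Fin d) ℝ))
      = {U | star U * U = 1} := by
    ext U
    exact Matrix.mem_unitaryGroup_iff'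
  refine isCompact_iff_compactSpace.mp ?_
  refine IsCompact.of_isClosed_subset (s := (Set.pi Set.univ fun _ : Fin d =>
      Set.pi Set.univ fun _ : Fin d => Set.Icc (-1 : ℝ) 1)) hK (hset ▸ hcl) ?_
  intro U hU i _ j _
  exact abs_le.mp (entry_norm_bound_of_unitary (𝕜 := ℝ) hU i j)

/-- The normalized Haar measure `dO` on the orthogonal group `O(d)`: the left-invariant measure of
total mass one. -/
noncomputable def haarOrthogonal (d : ℕ) : Measure (Matrix.orthogonalGroup (Fin d) ℝ) :=
  Measure.haarMeasure ⊤

/-- The Hilbert-Schmidt inner product `⟨X, Y⟩ = trace (X Y*)`. -/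
def hsInner {d : ℕ} (X Y : Matrix (Fin d) (Fin d) ℝ) : ℝ :=
  (X * Y.transpose).trace

/-- The diagonal matrix `D_λ = diag (λ₁, …, λ_k, 0, …, 0)` of size `d × d`, for the vector
`l = (λ₁, …, λ_k)` of nonzero eigenvalues. -/
def spectrumDiag {k : ℕ} (l : Fin k → ℝ) (d : ℕ) : Matrix (Fin d) (Fin d) ℝ :=
  Matrix.diagonal fun i => if h : (i : ℕ) < k then l ⟨i, h⟩ else 0

/-- The measurement matrix `O D_λ O*`. -/
def conjDiag {k : ℕ} (l : Fin k → ℝ) (d : ℕ) (O : Matrix.orthogonalGroup (Fin d) ℝ) :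
    Matrix (Fin d) (Fin d) ℝ :=
  (O : Matrix (Fin d) (Fin d) ℝ) * spectrumDiag l d *
    (O : Matrix (Fin d) (Fin d) ℝ).transpose

/-- The set `𝒢_{λ,d} = {O D_λ O* : O ∈ O(d)}`. -/
def measurementSet {k : ℕ} (l : Fin k → ℝ) (d : ℕ) : Set (Matrix (Fin d) (Fin d) ℝ) :=
  Set.range (conjDiag l d)

/-- The orthogonally invariant probability measure `σ_{λ,d}` on `𝒢_{λ,d}` (as a measure on all
matrices): the image of the Haar measure under `O ↦ O D_λ O*`. -/
noncomputable def sigmaMeasure {k : ℕ} (l : Fin k → ℝ) (d : ℕ) :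
    Measure (Matrix (Fin d) (Fin d) ℝ) :=
  (haarOrthogonal d).map (conjDiag l d)

/-- The `t`-th trace moment `μ^t_𝒫(X) = 𝔼 ⟨𝒫, X⟩^t` of a random matrix `𝒫`. -/
noncomputable def traceMoment {Ω : Type*} [MeasurableSpace Ω] {d : ℕ} (μ : Measure Ω)
    (P : Ω → Matrix (Fin d) (Fin d) ℝ) (t : ℕ) (X : Matrix (Fin d) (Fin d) ℝ) : ℝ :=
  ∫ s, hsInner (P s) X ^ t ∂μ

/-- The `t`-th trace moment `μ^t_{λ,d}(X) = ∫ ⟨P, X⟩^t dσ_{λ,d}(P)`. -/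
noncomputable def sigmaMoment {k : ℕ} (l : Fin k → ℝ) (d t : ℕ)
    (X : Matrix (Fin d) (Fin d) ℝ) : ℝ :=
  ∫ P, hsInner P X ^ t ∂(sigmaMeasure l d)

/-- `P` is a `𝒢_{λ,d}`-valued random variable. -/
structure IsRandomMeasurement {Ω : Type*} [MeasurableSpace Ω] {k : ℕ} (l : Fin k → ℝ) {d : ℕ}
    (μ : Measure Ω) (P : Ω → Matrix (Fin d) (Fin d) ℝ) : Prop where
  aemeasurable : AEMeasurable P μ
  mem : ∀ᵐ s ∂μ, P s ∈ measurementSet l d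

/-- Random cubature of strength `t` in `𝒢_{λ,d}`: the `t`-th trace moments coincide with those of
`σ_{λ,d}` at every symmetric matrix. -/
structure IsRandomCubature {Ω : Type*} [MeasurableSpace Ω] {k : ℕ} (l : Fin k → ℝ) {d : ℕ}
    (t : ℕ) (μ : Measure Ω) (P : Ω → Matrix (Fin d) (Fin d) ℝ) : Prop
    extends IsRandomMeasurement l μ P where
  moment_eq : ∀ X : Matrix (Fin d) (Fin d) ℝ, X.IsSymm →
    traceMoment μ P t X = sigmaMoment l d t X

/-- The rank-one matrix `x x*`. -/
def rankOne {d : ℕ} (x : EuclideanSpace ℝ (Fin d)) : Matrix (Fin d) (Fin d) ℝ :=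
  Matrix.vecMulVec x.ofLp x.ofLp

/-- Random tight `t`-fusion frame: the `t`-th trace moments coincide with those of `σ_{λ,d}` at
every `x x*`. -/
structure IsRandomTightFusionFrame {Ω : Type*} [MeasurableSpace Ω] {k : ℕ} (l : Fin k → ℝ) {d : ℕ}
    (t : ℕ) (μ : Measure Ω) (P : Ω → Matrix (Fin d) (Fin d) ℝ) : Prop
    extends IsRandomMeasurement l μ P where
  moment_eq : ∀ x : EuclideanSpace ℝ (Fin d),
    traceMoment μ P t (rankOne x) = sigmaMoment l d t (rankOne x)

/-- `X` solves the feasibility problem for the signal `x` and the measurement matrices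
`P₁, …, P_n`, with `‖x‖²` known: `X` is symmetric positive semidefinite, `⟨X, I⟩ = ‖x‖²`, and
`⟨X, P_j⟩ = ⟨x x*, P_j⟩` for all `j`. -/
structure IsFeasible {d n : ℕ} (x : EuclideanSpace ℝ (Fin d))
    (P : Fin n → Matrix (Fin d) (Fin d) ℝ) (X : Matrix (Fin d) (Fin d) ℝ) : Prop where
  posSemidef : X.PosSemidef
  norm_known : hsInner X 1 = ‖x‖ ^ 2
  measurement : ∀ j, hsInner X (P j) = hsInner (rankOne x) (P j)

/-- `X` is the unique solution of the feasibility problem. -/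
def IsUniqueSolution {d n : ℕ} (x : EuclideanSpace ℝ (Fin d))
    (P : Fin n → Matrix (Fin d) (Fin d) ℝ) (X : Matrix (Fin d) (Fin d) ℝ) : Prop :=
  IsFeasible x P X ∧ ∀ Y, IsFeasible x P Y → Y = X

end PhaseRetrieval

/-! Uniqueness is a statement about descent directions. Let `e` be the normalised signal, `X`
feasible and `Δ` the difference of `X` and the signal matrix. Then `Δ = e z* + z e* + W`, where `W`
is the compression of `X` to the complement of `e`, hence positive semidefinite, and `tr W = -2⟨e,
z⟩` because `Δ` is traceless. If `z = 0` then `W = 0`; otherwise rescale to `‖z‖ = 1`, `tr W ≤ 2`.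
It remains to see that, with high probability, no such `Δ` is orthogonal to all measurements
(`IsGoodSample.eq_of_posSemidef`).

Moments: strength three controls third moments, and also second moments because the trace is
constant on `𝒢_{λ,d}`. The second moment of `d⟨P, Z⟩` is bounded below independently of `d`, and for
the matrices that occur the third is bounded above, so the truncated mean `E min(|d⟨P, Z⟩|, M)` is
at least some `β > 0`. Truncated variables are bounded, so Hoeffding's inequality applies.

Entropy: general `W` form too large a family for a union bound of the desired size, so the estimates
are proved only for `W` an average of `r` rank-one matrices, with `r` independent of `d`. A
polynomially fine grid then has logarithmic cardinality of order `d log d`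
(`measure_not_isGoodSample_le`).

From low rank to all `W`: with `W = ∑ w_i v_i v_i*`, the sign vectors `g = ∑ ±√w_i v_i` satisfy `E
gg* = W`, have constant norm and are orthogonal to `e`. Put `f_j = ⟨Q_j, W⟩`. If `Δ` is invisible,
replacing `W` by an average of `r = 3ρ²` independent copies of `gg*` leaves a pure fluctuation of
size at most `f_j / ρ`. The lower estimate gives `nβ/4 ≤ ρ⁻¹ ∑ min(d f_j, Mρ)`, while the rank-one
upper estimate bounds the last sum by a fixed multiple of `n`. A large constant `ρ` gives a
contradiction (`IsGoodSample.not_forall_hsInner_eq_zero`). -/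

namespace PhaseRetrieval

open Finset Matrix
open scoped BigOperators

/-! ### Moments of Rademacher sums and truncated averages -/

section Rademacher

/-- The sign attached to a Boolean. -/
def sgn (b : Bool) : ℝ := if b then 1 else -1

/-- The Rademacher linear form `∑ i, ξ i * a i`. -/
def signSum {m : ℕ} (a : Fin m → ℝ) (ξ : Fin m → Bool) : ℝ := ∑ i, sgn (ξ i) * a i

lemma expect_cons {α : Type*} [Fintype α] {m : ℕ} (F : (Fin (m + 1) → α) → ℝ) :
    𝔼 ω, F ω = 𝔼 a, 𝔼 ω, F (Fin.cons a ω) := by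
  rw [← Fintype.expect_equiv (Fin.consEquiv fun _ => α) (fun p => F (Fin.cons p.1 p.2)) F
    (fun _ => rfl), ← Finset.univ_product_univ, Finset.expect_product]

lemma expect_bool (F : Bool → ℝ) : 𝔼 b, F b = (F true + F false) / 2 := by
  rw [Fintype.expect_eq_sum_div_card]
  simp

lemma signSum_cons {m : ℕ} (a : Fin (m + 1) → ℝ) (b : Bool) (ξ : Fin m → Bool) :
    signSum a (Fin.cons b ξ) = sgn b * a 0 + signSum (fun i => a i.succ) ξ := by
  simp [signSum, Fin.sum_univ_succ]

lemma expect_signSum_sq {m : ℕ} (a : Fin m → ℝ) : 𝔼 ξ, signSum a ξ ^ 2 = ∑ i, a i ^ 2 := by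
  induction m with
  | zero => simp [signSum]
  | succ m ih =>
    rw [expect_cons, expect_bool, ← Finset.expect_add_distrib, Finset.expect_div, Fin.sum_univ_succ,
      ← ih]
    have : ∀ ξ : Fin m → Bool, (signSum a (Fin.cons true ξ) ^ 2 +
        signSum a (Fin.cons false ξ) ^ 2) / 2 = a 0 ^ 2 + signSum (fun i => a i.succ) ξ ^ 2 := by
      intro ξ
      simp only [signSum_cons, sgn]
      simp
      ring
    simp_rw [this, Finset.expect_add_distrib, Fintype.expect_const]

/-- Averaging over the first sign kills the odd powers, which makes an induction on the number of
signs possible. The constants 3 here and 15 for the sixth power are the Gaussian moments. -/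
lemma expect_signSum_pow_four_le {m : ℕ} (a : Fin m → ℝ) :
    𝔼 ξ, signSum a ξ ^ 4 ≤ 3 * (∑ i, a i ^ 2) ^ 2 := by
  induction m with
  | zero => simp [signSum]
  | succ m ih =>
    rw [expect_cons, expect_bool, ← Finset.expect_add_distrib, Finset.expect_div, Fin.sum_univ_succ]
    have : ∀ ξ : Fin m → Bool, (signSum a (Fin.cons true ξ) ^ 4 +
        signSum a (Fin.cons false ξ) ^ 4) / 2 =
        a 0 ^ 4 + (6 * a 0 ^ 2) * signSum (fun i => a i.succ) ξ ^ 2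
          + signSum (fun i => a i.succ) ξ ^ 4 := by
      intro ξ
      simp only [signSum_cons, sgn]
      simp
      ring
    simp_rw [this, Finset.expect_add_distrib, Fintype.expect_const, ← Finset.mul_expect,
      expect_signSum_sq]
    nlinarith [ih (fun i => a i.succ), sq_nonneg (a 0 ^ 2)]

lemma expect_signSum_pow_six_le {m : ℕ} (a : Fin m → ℝ) :
    𝔼 ξ, signSum a ξ ^ 6 ≤ 15 * (∑ i, a i ^ 2) ^ 3 := by
  induction m with
  | zero => simp [signSum]
  | succ m ih =>
    rw [expect_cons, expect_bool, ← Finset.expect_add_distrib, Finset.expect_div, Fin.sum_univ_succ]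
    have : ∀ ξ : Fin m → Bool, (signSum a (Fin.cons true ξ) ^ 6 +
        signSum a (Fin.cons false ξ) ^ 6) / 2 =
        a 0 ^ 6 + (15 * a 0 ^ 4) * signSum (fun i => a i.succ) ξ ^ 2
          + (15 * a 0 ^ 2) * signSum (fun i => a i.succ) ξ ^ 4
          + signSum (fun i => a i.succ) ξ ^ 6 := by
      intro ξ
      simp only [signSum_cons, sgn]
      simp
      ring
    simp_rw [this, Finset.expect_add_distrib, Fintype.expect_const, ← Finset.mul_expect,
      expect_signSum_sq]
    have h4 := mul_le_mul_of_nonneg_left (expect_signSum_pow_four_le fun i => a (Fin.succ i))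
      (show 0 ≤ 15 * a 0 ^ 2 by positivity)
    have h6 := ih (fun i => a i.succ)
    have hs : 0 ≤ ∑ i : Fin m, a i.succ ^ 2 := Finset.sum_nonneg fun _ _ => sq_nonneg _
    set s := ∑ i : Fin m, a i.succ ^ 2
    have h0 : 0 ≤ a 0 ^ 6 := by positivity
    have h1 : 0 ≤ a 0 ^ 4 * s := by positivity
    have : 15 * (a 0 ^ 2 + s) ^ 3 = 15 * a 0 ^ 6 + 45 * (a 0 ^ 4 * s) + 45 * a 0 ^ 2 * s ^ 2
      + 15 * s ^ 3 := by ring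
    rw [this]
    linarith

variable {ι : Type*} [Fintype ι] {m : ℕ}

lemma expect_weighted_sq (w : ι → ℝ) (a : ι → Fin m → ℝ) :
    𝔼 ξ, ∑ i, w i * signSum (a i) ξ ^ 2 = ∑ i, w i * ∑ j, a i j ^ 2 := by
  rw [Finset.expect_sum_comm]
  simp_rw [← Finset.mul_expect, expect_signSum_sq]

lemma expect_signSum_sq_mul_sq_le (a b : Fin m → ℝ) :
    𝔼 ξ, signSum a ξ ^ 2 * signSum b ξ ^ 2 ≤ 3 * (∑ i, a i ^ 2) * ∑ i, b i ^ 2 := by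
  have hcs := Finset.expect_mul_sq_le_sq_mul_sq Finset.univ
    (fun ξ : Fin m → Bool => signSum a ξ ^ 2) (fun ξ => signSum b ξ ^ 2)
  simp only [← pow_mul] at hcs
  norm_num at hcs
  have ha := expect_signSum_pow_four_le a
  have hb := expect_signSum_pow_four_le b
  have ha0 : 0 ≤ ∑ i, a i ^ 2 := Finset.sum_nonneg fun _ _ => sq_nonneg _
  have hb0 : 0 ≤ ∑ i, b i ^ 2 := Finset.sum_nonneg fun _ _ => sq_nonneg _
  refine le_of_abs_le (abs_le_of_sq_le_sq (hcs.trans ?_) (by positivity))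
  calc _ ≤ (3 * (∑ i, a i ^ 2) ^ 2) * (3 * (∑ i, b i ^ 2) ^ 2) :=
        mul_le_mul ha hb (Finset.expect_nonneg fun _ _ => by positivity) (by positivity)
    _ = _ := by ring

/-- Expand the square and apply Cauchy–Schwarz to each pair of sign sums. The constant does not
depend on the number of terms, which is what makes the later variance bound dimension-free. -/
lemma expect_weighted_sq_sq_le (w : ι → ℝ) (hw : ∀ i, 0 ≤ w i) (a : ι → Fin m → ℝ) :
    𝔼 ξ, (∑ i, w i * signSum (a i) ξ ^ 2) ^ 2 ≤ 3 * (∑ i, w i * ∑ j, a i j ^ 2) ^ 2 := by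
  simp_rw [sq (∑ i, w i * _), Finset.sum_mul_sum, Finset.expect_sum_comm, Finset.mul_sum]
  refine Finset.sum_le_sum fun i _ => Finset.sum_le_sum fun j _ => ?_
  have h := mul_le_mul_of_nonneg_left (expect_signSum_sq_mul_sq_le (a i) (a j))
    (mul_nonneg (hw i) (hw j))
  rw [Finset.mul_expect] at h
  simp_rw [← Finset.mul_sum]
  refine (le_of_eq ?_).trans (h.trans (le_of_eq ?_))
  · exact Finset.expect_congr rfl fun ξ _ => by ring
  · ring

/-- Jensen's inequality for the cube, with the weights normalised to total mass one. -/
lemma weighted_sum_pow_three_le (w : ι → ℝ) (hw : ∀ i, 0 ≤ w i) (y : ι → ℝ) (hy : ∀ i, 0 ≤ y i) :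
    (∑ i, w i * y i) ^ 3 ≤ (∑ i, w i) ^ 2 * ∑ i, w i * y i ^ 3 := by
  rcases eq_or_ne (∑ i, w i) 0 with h0 | h0
  · have : ∀ i, w i = 0 := fun i =>
      (Finset.sum_eq_zero_iff_of_nonneg fun i _ => hw i).1 h0 i (Finset.mem_univ i)
    simp [this]
  · have hpos : 0 < ∑ i, w i := lt_of_le_of_ne (Finset.sum_nonneg fun i _ => hw i) (Ne.symm h0)
    have h := Real.pow_arith_mean_le_arith_mean_pow Finset.univ (fun i => w i / ∑ j, w j) y
      (fun i _ => div_nonneg (hw i) hpos.le) (by rw [← Finset.sum_div, div_self h0])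
      (fun i _ => hy i) 3
    simp_rw [div_mul_eq_mul_div, ← Finset.sum_div] at h
    rw [div_pow, div_le_div_iff₀ (by positivity) hpos] at h
    have : 0 < (∑ i, w i) := hpos
    refine le_of_mul_le_mul_right (h.trans (le_of_eq ?_)) this
    ring

lemma expect_weighted_sq_pow_three_le (w : ι → ℝ) (hw : ∀ i, 0 ≤ w i) (a : ι → Fin m → ℝ) (A : ℝ)
    (ha : ∀ i, ∑ j, a i j ^ 2 ≤ A) :
    𝔼 ξ, (∑ i, w i * signSum (a i) ξ ^ 2) ^ 3 ≤ 15 * (∑ i, w i) ^ 3 * A ^ 3 := by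
  calc _ ≤ 𝔼 ξ, (∑ i, w i) ^ 2 * ∑ i, w i * (signSum (a i) ξ ^ 2) ^ 3 :=
        Finset.expect_le_expect fun ξ _ => weighted_sum_pow_three_le w hw _ fun i => sq_nonneg _
    _ = (∑ i, w i) ^ 2 * ∑ i, w i * 𝔼 ξ, signSum (a i) ξ ^ 6 := by
        rw [← Finset.mul_expect, Finset.expect_sum_comm]
        simp_rw [← Finset.mul_expect, ← pow_mul]
    _ ≤ (∑ i, w i) ^ 2 * ∑ i, w i * (15 * A ^ 3) := by
        refine mul_le_mul_of_nonneg_left (Finset.sum_le_sum fun i _ =>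
          mul_le_mul_of_nonneg_left ?_ (hw i)) (sq_nonneg _)
        refine (expect_signSum_pow_six_le _).trans (mul_le_mul_of_nonneg_left ?_ (by norm_num))
        exact pow_le_pow_left₀ (Finset.sum_nonneg fun _ _ => sq_nonneg _) (ha i) 3
    _ = _ := by rw [← Finset.sum_mul]; ring

/-- The second moment of a sum of independent centred variables on a finite uniform space. -/
lemma expect_sum_sq {α : Type*} [Fintype α] [Nonempty α] (h : α → ℝ) (h0 : 𝔼 a, h a = 0) (r : ℕ) :
    𝔼 ω : Fin r → α, (∑ l, h (ω l)) ^ 2 = r * 𝔼 a, h a ^ 2 := by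
  induction r with
  | zero => simp
  | succ r ih =>
    rw [expect_cons]
    simp_rw [Fin.sum_univ_succ, Fin.cons_zero, Fin.cons_succ, add_sq, Finset.expect_add_distrib, ih,
      Fintype.expect_const, mul_assoc, ← Finset.mul_expect, ← Finset.expect_mul, h0]
    push_cast
    ring

/-- Averages of `min |Y| M` are bounded through the second moment. -/
lemma expect_min_abs_le {α : Type*} [Fintype α] [Nonempty α] (Y : α → ℝ) {s M : ℝ} (hs : 0 ≤ s)
    (h : 𝔼 a, Y a ^ 2 ≤ s ^ 2) : 𝔼 a, min |Y a| M ≤ min s M := by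
  refine le_min ?_ (Finset.expect_le Finset.univ_nonempty fun _ _ => min_le_right _ _)
  refine (Finset.expect_le_expect fun a _ => min_le_left _ _).trans ?_
  have hcs := Finset.expect_mul_sq_le_sq_mul_sq Finset.univ (fun a => |Y a|) (fun _ : α => (1 : ℝ))
  simp only [mul_one, sq_abs, one_pow, Fintype.expect_const] at hcs
  exact le_of_abs_le (abs_le_of_sq_le_sq (hcs.trans h) hs)

/-- A lower bound for truncated averages of nonnegative variables whose second moment is controlled
by the square of the first one. -/
lemma half_min_le_expect_min {α : Type*} [Fintype α] [Nonempty α] (Y : α → ℝ) (hY : ∀ a, 0 ≤ Y a)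
    {f K : ℝ} (hK : 0 < K) (h1 : 𝔼 a, Y a = f) (h2 : 𝔼 a, Y a ^ 2 ≤ 3 * f ^ 2) :
    1 / 2 * min f K ≤ 𝔼 a, min (Y a) (3 / 2 * K) := by
  have hf : 0 ≤ f := h1 ▸ Finset.expect_nonneg fun a _ => hY a
  rcases hf.eq_or_lt with hf0 | hf0
  · rw [← hf0, min_eq_left hK.le, mul_zero]
    exact Finset.expect_nonneg fun a _ => le_min (hY a) (by positivity)
  -- Test against a parabola: `c y - (c y)² / (6K)` lies below `y` since `c ≤ 1`, and its maximum,
  -- attained at `c y = 3K`, is `3K/2`. This is where the truncation level `3/2 * K` comes from.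
  set c := min f K / f with hc
  have hm : 0 < min f K := lt_min hf0 hK
  have hc0 : 0 < c := div_pos hm hf0
  have hc1 : c ≤ 1 := div_le_one_of_le₀ (min_le_left _ _) hf
  have hcf : c * f = min f K := div_mul_cancel₀ _ hf0.ne'
  have hp : ∀ a, c * Y a - c ^ 2 / (6 * K) * Y a ^ 2 ≤ min (Y a) (3 / 2 * K) := by
    intro a
    refine le_min ?_ ?_
    · have h1 : c * Y a ≤ 1 * Y a := mul_le_mul_of_nonneg_right hc1 (hY a)
      have : 0 ≤ c ^ 2 / (6 * K) * Y a ^ 2 := by positivity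
      linarith
    · have : c * Y a - c ^ 2 / (6 * K) * Y a ^ 2 = 3 / 2 * K - (c * Y a - 3 * K) ^ 2 / (6 * K) := by
        field_simp
        ring
      rw [this]
      have : 0 ≤ (c * Y a - 3 * K) ^ 2 / (6 * K) := by positivity
      linarith
  refine le_trans ?_ (Finset.expect_le_expect fun a _ => hp a)
  rw [Finset.expect_sub_distrib, ← Finset.mul_expect, ← Finset.mul_expect, h1, hcf]
  have h3 : c ^ 2 / (6 * K) * 𝔼 a, Y a ^ 2 ≤ c ^ 2 / (6 * K) * (3 * f ^ 2) :=
    mul_le_mul_of_nonneg_left h2 (by positivity)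
  have h4 : c ^ 2 / (6 * K) * (3 * f ^ 2) = (c * f) * (c * f) / (2 * K) := by
    field_simp
    ring
  have h5 : (c * f) * (c * f) / (2 * K) ≤ (c * f) * K / (2 * K) := by
    gcongr
    rw [hcf]
    exact min_le_right _ _
  have h6 : (c * f) * K / (2 * K) = 1 / 2 * min f K := by
    rw [hcf]
    field_simp
  linarith

end Rademacher

/-! ### Quadratic forms, the trace inner product and orthogonal matrices -/

section LinearAlgebra

variable {d : ℕ}

/-- The bilinear form `(u, v) ↦ ⟨u, P v⟩`. -/
def form (P : Matrix (Fin d) (Fin d) ℝ) (u v : Fin d → ℝ) : ℝ := u ⬝ᵥ (P *ᵥ v)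

lemma form_add_left (P : Matrix (Fin d) (Fin d) ℝ) (u v w : Fin d → ℝ) :
    form P (u + v) w = form P u w + form P v w := add_dotProduct _ _ _

lemma form_add_right (P : Matrix (Fin d) (Fin d) ℝ) (u v w : Fin d → ℝ) :
    form P u (v + w) = form P u v + form P u w := by
  simp [form, mulVec_add, dotProduct_add]

lemma form_sub_left (P : Matrix (Fin d) (Fin d) ℝ) (u v w : Fin d → ℝ) :
    form P (u - v) w = form P u w - form P v w := sub_dotProduct _ _ _

lemma form_sub_right (P : Matrix (Fin d) (Fin d) ℝ) (u v w : Fin d → ℝ) :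
    form P u (v - w) = form P u v - form P u w := by
  simp [form, mulVec_sub, dotProduct_sub]

lemma form_smul_left (P : Matrix (Fin d) (Fin d) ℝ) (c : ℝ) (u v : Fin d → ℝ) :
    form P (c • u) v = c * form P u v := by
  simp [form]

lemma form_smul_right (P : Matrix (Fin d) (Fin d) ℝ) (c : ℝ) (u v : Fin d → ℝ) :
    form P u (c • v) = c * form P u v := by
  simp [form, mulVec_smul]

lemma form_conj (V P : Matrix (Fin d) (Fin d) ℝ) (u v : Fin d → ℝ) :
    form (Vᵀ * P * V) u v = form P (V *ᵥ u) (V *ᵥ v) := by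
  simp only [form, ← mulVec_mulVec, dotProduct_mulVec, vecMul_transpose]

lemma form_diagonal (w u v : Fin d → ℝ) : form (diagonal w) u v = ∑ i, w i * (u i * v i) := by
  simp only [form, dotProduct, mulVec_diagonal]
  exact Finset.sum_congr rfl fun i _ => by ring

lemma form_conj_diagonal (V : Matrix (Fin d) (Fin d) ℝ) (w u v : Fin d → ℝ) :
    form (V * diagonal w * Vᵀ) u v = ∑ i, w i * ((Vᵀ *ᵥ u) i * (Vᵀ *ᵥ v) i) := by
  have h := form_conj Vᵀ (diagonal w) u v
  rw [transpose_transpose] at h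
  rw [h, form_diagonal]

lemma form_single (P : Matrix (Fin d) (Fin d) ℝ) (a b : Fin d) :
    form P (Pi.single a 1) (Pi.single b 1) = P a b := by
  simp [form]

lemma hsInner_vecMulVec (P : Matrix (Fin d) (Fin d) ℝ) (u v : Fin d → ℝ) :
    hsInner P (vecMulVec u v) = form P u v := by
  simp only [hsInner, form, trace, diag_apply, mul_apply, transpose_apply, vecMulVec_apply,
    dotProduct, mulVec, Finset.mul_sum]
  exact Finset.sum_congr rfl fun i _ => Finset.sum_congr rfl fun j _ => by ring

lemma hsInner_add_right (P X Y : Matrix (Fin d) (Fin d) ℝ) :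
    hsInner P (X + Y) = hsInner P X + hsInner P Y := by
  simp [hsInner, mul_add]

lemma hsInner_sub_right (P X Y : Matrix (Fin d) (Fin d) ℝ) :
    hsInner P (X - Y) = hsInner P X - hsInner P Y := by
  simp [hsInner, mul_sub]

lemma hsInner_smul_right (P X : Matrix (Fin d) (Fin d) ℝ) (c : ℝ) :
    hsInner P (c • X) = c * hsInner P X := by
  simp [hsInner]

lemma hsInner_sum_right {ι : Type*} (s : Finset ι) (P : Matrix (Fin d) (Fin d) ℝ)
    (X : ι → Matrix (Fin d) (Fin d) ℝ) :
    hsInner P (∑ i ∈ s, X i) = ∑ i ∈ s, hsInner P (X i) := by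
  simp [hsInner, transpose_sum, Finset.mul_sum, trace_sum]

lemma hsInner_one_right (P : Matrix (Fin d) (Fin d) ℝ) : hsInner P 1 = P.trace := by
  simp [hsInner]

lemma hsInner_comm (X Y : Matrix (Fin d) (Fin d) ℝ) : hsInner X Y = hsInner Y X := by
  rw [hsInner, hsInner, ← trace_transpose, transpose_mul, transpose_transpose]

lemma conj_diagonal_eq_sum (V : Matrix (Fin d) (Fin d) ℝ) (w : Fin d → ℝ) :
    V * diagonal w * Vᵀ = ∑ a, w a • vecMulVec (Vᵀ a) (Vᵀ a) := by
  ext i j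
  rw [mul_apply, Matrix.sum_apply]
  simp only [mul_diagonal, transpose_apply, Matrix.smul_apply, vecMulVec_apply, smul_eq_mul]
  exact Finset.sum_congr rfl fun a _ => by ring

lemma hsInner_conj_diagonal (P V : Matrix (Fin d) (Fin d) ℝ) (w : Fin d → ℝ) :
    hsInner P (V * diagonal w * Vᵀ) = ∑ a, w a * form P (Vᵀ a) (Vᵀ a) := by
  simp only [conj_diagonal_eq_sum, hsInner_sum_right, hsInner_smul_right, hsInner_vecMulVec]

lemma transpose_mul_self_of_mem {V : Matrix (Fin d) (Fin d) ℝ}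
    (hV : V ∈ Matrix.orthogonalGroup (Fin d) ℝ) : Vᵀ * V = 1 :=
  (Matrix.mem_orthogonalGroup_iff' _ _).1 hV

lemma mul_transpose_self_of_mem {V : Matrix (Fin d) (Fin d) ℝ}
    (hV : V ∈ Matrix.orthogonalGroup (Fin d) ℝ) : V * Vᵀ = 1 :=
  (Matrix.mem_orthogonalGroup_iff _ _).1 hV

lemma mulVec_dotProduct_mulVec_of_mem {V : Matrix (Fin d) (Fin d) ℝ}
    (hV : V ∈ Matrix.orthogonalGroup (Fin d) ℝ) (u v : Fin d → ℝ) :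
    (V *ᵥ u) ⬝ᵥ (V *ᵥ v) = u ⬝ᵥ v := by
  rw [← vecMul_transpose, ← dotProduct_mulVec, mulVec_mulVec, transpose_mul_self_of_mem hV,
    one_mulVec]

lemma transpose_mem {V : Matrix (Fin d) (Fin d) ℝ}
    (hV : V ∈ Matrix.orthogonalGroup (Fin d) ℝ) : Vᵀ ∈ Matrix.orthogonalGroup (Fin d) ℝ := by
  rw [Matrix.mem_orthogonalGroup_iff', transpose_transpose]
  exact mul_transpose_self_of_mem hV

lemma exists_orthogonal_diagonalization {Z : Matrix (Fin d) (Fin d) ℝ} (hZ : Z.IsSymm) :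
    ∃ V ∈ Matrix.orthogonalGroup (Fin d) ℝ, ∃ w : Fin d → ℝ, Z = V * diagonal w * Vᵀ := by
  have hH : Z.IsHermitian := by
    rw [Matrix.IsHermitian, conjTranspose_eq_transpose_of_trivial]
    exact hZ
  refine ⟨hH.eigenvectorUnitary, hH.eigenvectorUnitary.2, hH.eigenvalues, ?_⟩
  have h := hH.spectral_theorem
  rw [Unitary.conjStarAlgAut_apply] at h
  simpa [star_eq_conjTranspose, conjTranspose_eq_transpose_of_trivial, Function.comp_def] using h

lemma dotProduct_mul_self_nonneg (u : Fin d → ℝ) : 0 ≤ u ⬝ᵥ u :=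
  Finset.sum_nonneg fun i _ => mul_self_nonneg (u i)

lemma dotProduct_sq_le (u v : Fin d → ℝ) : (u ⬝ᵥ v) ^ 2 ≤ (u ⬝ᵥ u) * (v ⬝ᵥ v) := by
  have h := Finset.sum_mul_sq_le_sq_mul_sq Finset.univ u v
  simpa [dotProduct, sq] using h

/-- Householder reflections act transitively on spheres. -/
lemma exists_orthogonal_mulVec_eq (a b : Fin d → ℝ) (hab : a ⬝ᵥ a = b ⬝ᵥ b) :
    ∃ V ∈ Matrix.orthogonalGroup (Fin d) ℝ, V *ᵥ a = b ∧
      ∀ c : Fin d → ℝ, c ⬝ᵥ a = c ⬝ᵥ b → V *ᵥ c = c := by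
  rcases eq_or_ne a b with rfl | hne
  · exact ⟨1, one_mem _, one_mulVec _, fun c _ => one_mulVec _⟩
  set h := a - b with hh
  have hpos : h ⬝ᵥ h ≠ 0 := fun h0 => hne (sub_eq_zero.1 (dotProduct_self_eq_zero.1 h0))
  have hact : ∀ c : Fin d → ℝ, (1 - (2 / (h ⬝ᵥ h)) • vecMulVec h h) *ᵥ c =
      c - (2 / (h ⬝ᵥ h) * (h ⬝ᵥ c)) • h := by
    intro c
    rw [sub_mulVec, one_mulVec, smul_mulVec, vecMulVec_mulVec]
    ext i
    simp
    ring
  refine ⟨1 - (2 / (h ⬝ᵥ h)) • vecMulVec h h, ?_, ?_, ?_⟩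
  · rw [Matrix.mem_orthogonalGroup_iff', transpose_sub, transpose_smul, transpose_one,
      transpose_vecMulVec, sub_mul, one_mul, smul_mul, mul_sub, mul_one, Matrix.mul_smul,
      vecMulVec_mul_vecMulVec]
    ext i j
    simp [vecMulVec_apply]
    field_simp
    ring
  · have : 2 * (h ⬝ᵥ a) = h ⬝ᵥ h := by
      simp only [hh, sub_dotProduct, dotProduct_sub, ← hab, dotProduct_comm b a]
      ring
    rw [hact, div_mul_eq_mul_div, this, div_self hpos, one_smul, hh, sub_sub_cancel]
  · intro c hc
    have : h ⬝ᵥ c = 0 := by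
      rw [dotProduct_comm, hh, dotProduct_sub, hc, sub_self]
    rw [hact, this, mul_zero, zero_smul, sub_zero]

/-- The orthogonal group acts transitively on orthonormal pairs. -/
lemma exists_orthogonal_mulVec_pair_eq {u v u' v' : Fin d → ℝ} (hu : u ⬝ᵥ u = 1) (hv : v ⬝ᵥ v = 1)
    (huv : u ⬝ᵥ v = 0) (hu' : u' ⬝ᵥ u' = 1) (hv' : v' ⬝ᵥ v' = 1) (huv' : u' ⬝ᵥ v' = 0) :
    ∃ V ∈ Matrix.orthogonalGroup (Fin d) ℝ, V *ᵥ u = u' ∧ V *ᵥ v = v' := by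
  obtain ⟨V, hV, h1, -⟩ := exists_orthogonal_mulVec_eq u u' (hu.trans hu'.symm)
  -- The second reflection does not move `u'`, because `u'` is orthogonal to both `V *ᵥ v` and `v'`.
  obtain ⟨U, hU, h2, h3⟩ := exists_orthogonal_mulVec_eq (V *ᵥ v) v'
    (by rw [mulVec_dotProduct_mulVec_of_mem hV, hv, hv'])
  refine ⟨U * V, mul_mem hU hV, ?_, ?_⟩
  · rw [← mulVec_mulVec, h1, h3]
    rw [huv', ← h1, mulVec_dotProduct_mulVec_of_mem hV, huv]
  · rw [← mulVec_mulVec, h2]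

end LinearAlgebra

/-! ### Deterministic properties of the measurement matrices -/

section Measurement

variable {k d : ℕ} {l : Fin k → ℝ} {P : Matrix (Fin d) (Fin d) ℝ}

/-- The diagonal of `D_λ`. -/
def spectrumVec (l : Fin k → ℝ) (d : ℕ) (i : Fin d) : ℝ := if h : (i : ℕ) < k then l ⟨i, h⟩ else 0

lemma sum_spectrumVec (hkd : k < d) (l : Fin k → ℝ) (F : ℝ → ℝ) (hF : F 0 = 0) :
    ∑ i, F (spectrumVec l d i) = ∑ i, F (l i) := by
  obtain ⟨m, rfl⟩ := Nat.exists_eq_add_of_lt hkd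
  rw [show k + m + 1 = k + (m + 1) by ring, Fin.sum_univ_add]
  simp [spectrumVec, hF]

lemma exists_of_mem_measurementSet (hP : P ∈ measurementSet l d) :
    ∃ V ∈ Matrix.orthogonalGroup (Fin d) ℝ, P = V * diagonal (spectrumVec l d) * Vᵀ := by
  obtain ⟨O, rfl⟩ := hP
  exact ⟨O, O.2, rfl⟩

lemma spectrumVec_nonneg (hl : ∀ i, 0 < l i) (i : Fin d) : 0 ≤ spectrumVec l d i := by
  unfold spectrumVec
  split_ifs with h
  · exact (hl _).le
  · exact le_rfl

lemma spectrumVec_le_one (hl : ∀ i, l i ≤ 1) (i : Fin d) : spectrumVec l d i ≤ 1 := by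
  unfold spectrumVec
  split_ifs with h
  · exact hl _
  · exact zero_le_one

lemma form_comm_of_mem (hP : P ∈ measurementSet l d) (u v : Fin d → ℝ) :
    form P u v = form P v u := by
  obtain ⟨V, -, rfl⟩ := exists_of_mem_measurementSet hP
  simp only [form_conj_diagonal]
  exact Finset.sum_congr rfl fun i _ => by ring

lemma form_self_nonneg (hl : ∀ i, 0 < l i) (hP : P ∈ measurementSet l d) (u : Fin d → ℝ) :
    0 ≤ form P u u := by
  obtain ⟨V, -, rfl⟩ := exists_of_mem_measurementSet hP
  rw [form_conj_diagonal]
  exact Finset.sum_nonneg fun i _ => mul_nonneg (spectrumVec_nonneg hl i) (mul_self_nonneg _)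

/-- The operator norm is at most one because all eigenvalues are; this makes the grid approximation
uniform over the measurements. -/
lemma form_sq_le (hl : ∀ i, 0 < l i) (hl1 : ∀ i, l i ≤ 1) (hP : P ∈ measurementSet l d)
    (u v : Fin d → ℝ) : form P u v ^ 2 ≤ (u ⬝ᵥ u) * (v ⬝ᵥ v) := by
  obtain ⟨V, hV, rfl⟩ := exists_of_mem_measurementSet hP
  rw [← mulVec_dotProduct_mulVec_of_mem (transpose_mem hV) u u,
    ← mulVec_dotProduct_mulVec_of_mem (transpose_mem hV) v v]
  have h := Finset.sum_mul_sq_le_sq_mul_sq Finset.univ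
    (fun i => spectrumVec l d i * (Vᵀ *ᵥ u) i) (Vᵀ *ᵥ v)
  rw [form_conj_diagonal]
  simp_rw [← mul_assoc]
  refine h.trans (mul_le_mul ?_ (le_of_eq ?_) (Finset.sum_nonneg fun _ _ => sq_nonneg _)
    (dotProduct_mul_self_nonneg _))
  · refine Finset.sum_le_sum fun i _ => ?_
    rw [mul_pow, ← sq]
    exact mul_le_of_le_one_left (sq_nonneg _)
      (pow_le_one₀ (spectrumVec_nonneg hl i) (spectrumVec_le_one hl1 i))
  · simp [dotProduct, sq]

/-- Positivity at `u ± v` bounds the cross term, so that moments at `x z* + z x*` reduce to moments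
at rank-one matrices. -/
lemma form_mul_self_le (hl : ∀ i, 0 < l i) (hP : P ∈ measurementSet l d) (u v : Fin d → ℝ) :
    2 * |form P u v| ≤ form P u u + form P v v := by
  have h1 := form_self_nonneg hl hP (u + v)
  have h2 := form_self_nonneg hl hP (u - v)
  simp only [form_add_left, form_add_right, form_sub_left, form_sub_right,
    form_comm_of_mem hP v u] at h1 h2
  rw [← abs_two, ← abs_mul, abs_le]
  constructor <;> linarith

lemma trace_of_mem (hkd : k < d) (hP : P ∈ measurementSet l d) : P.trace = ∑ i, l i := by
  obtain ⟨V, hV, rfl⟩ := exists_of_mem_measurementSet hP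
  rw [trace_mul_comm, ← mul_assoc, transpose_mul_self_of_mem hV, one_mul, trace_diagonal]
  exact sum_spectrumVec hkd l id rfl

lemma transpose_of_mem (hP : P ∈ measurementSet l d) : Pᵀ = P := by
  obtain ⟨V, hV, rfl⟩ := exists_of_mem_measurementSet hP
  simp [transpose_mul, mul_assoc]

lemma sum_entry_sq_of_mem (hkd : k < d) (hP : P ∈ measurementSet l d) :
    ∑ a, ∑ b, P a b ^ 2 = ∑ i, l i ^ 2 := by
  have h1 : ∑ a, ∑ b, P a b ^ 2 = (P * Pᵀ).trace := by
    simp [trace, mul_apply, sq]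
  rw [h1, transpose_of_mem hP]
  obtain ⟨V, hV, rfl⟩ := exists_of_mem_measurementSet hP
  have h2 : V * diagonal (spectrumVec l d) * Vᵀ * (V * diagonal (spectrumVec l d) * Vᵀ) =
      V * (diagonal (spectrumVec l d) * (Vᵀ * V) * diagonal (spectrumVec l d)) * Vᵀ := by
    simp only [mul_assoc]
  rw [h2, transpose_mul_self_of_mem hV, mul_one, trace_mul_comm, ← mul_assoc,
    transpose_mul_self_of_mem hV, one_mul, diagonal_mul_diagonal, trace_diagonal,
    ← sum_spectrumVec hkd l (fun x => x ^ 2) (by simp)]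
  exact Finset.sum_congr rfl fun i _ => by ring

end Measurement

/-! ### Invariance and moments of `σ_{λ,d}` -/

section Haar

variable {k d : ℕ}

instance instIsProbabilityMeasureHaarOrthogonal (d : ℕ) :
    IsProbabilityMeasure (haarOrthogonal d) :=
  ⟨by simpa [haarOrthogonal] using
    Measure.haarMeasure_self (K₀ := (⊤ : TopologicalSpace.PositiveCompacts
      (Matrix.orthogonalGroup (Fin d) ℝ)))⟩

instance instIsMulLeftInvariantHaarOrthogonal (d : ℕ) :
    (haarOrthogonal d).IsMulLeftInvariant := by
  unfold haarOrthogonal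
  infer_instance

lemma continuous_conjDiag (l : Fin k → ℝ) (d : ℕ) : Continuous (conjDiag l d) := by
  unfold conjDiag
  fun_prop

@[fun_prop]
lemma continuous_hsInner (Z : Matrix (Fin d) (Fin d) ℝ) :
    Continuous fun P : Matrix (Fin d) (Fin d) ℝ => hsInner P Z := by
  unfold hsInner
  fun_prop

@[fun_prop]
lemma continuous_form (u v : Fin d → ℝ) :
    Continuous fun P : Matrix (Fin d) (Fin d) ℝ => form P u v := by
  unfold form
  fun_prop

lemma isCompact_measurementSet (l : Fin k → ℝ) (d : ℕ) : IsCompact (measurementSet l d) :=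
  isCompact_range (continuous_conjDiag l d)

instance instIsProbabilityMeasureSigmaMeasure (l : Fin k → ℝ) (d : ℕ) :
    IsProbabilityMeasure (sigmaMeasure l d) :=
  Measure.isProbabilityMeasure_map (continuous_conjDiag l d).aemeasurable

lemma ae_sigmaMeasure_mem (l : Fin k → ℝ) (d : ℕ) :
    ∀ᵐ P ∂(sigmaMeasure l d), P ∈ measurementSet l d := by
  refine (ae_map_iff (continuous_conjDiag l d).aemeasurable
    (isCompact_measurementSet l d).measurableSet).2 ?_
  exact Filter.Eventually.of_forall fun O => ⟨O, rfl⟩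

/-- A continuous function is integrable for a probability measure carried by `𝒢_{λ,d}`. -/
lemma integrable_of_continuous {l : Fin k → ℝ} {ν : Measure (Matrix (Fin d) (Fin d) ℝ)}
    [IsProbabilityMeasure ν] (hν : ∀ᵐ P ∂ν, P ∈ measurementSet l d)
    {F : Matrix (Fin d) (Fin d) ℝ → ℝ} (hF : Continuous F) : Integrable F ν := by
  obtain ⟨C, hC⟩ := (isCompact_measurementSet l d).exists_bound_of_continuousOn hF.continuousOn
  exact Integrable.of_bound hF.aestronglyMeasurable C (hν.mono fun P hP => hC P hP)

lemma integral_sigmaMeasure {l : Fin k → ℝ} {F : Matrix (Fin d) (Fin d) ℝ → ℝ}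
    (hF : Continuous F) :
    ∫ P, F P ∂(sigmaMeasure l d) = ∫ O, F (conjDiag l d O) ∂(haarOrthogonal d) :=
  integral_map (continuous_conjDiag l d).aemeasurable hF.aestronglyMeasurable

/-- Orthogonal invariance of `σ_{λ,d}`. -/
lemma integral_sigmaMeasure_conj {l : Fin k → ℝ} {F : Matrix (Fin d) (Fin d) ℝ → ℝ}
    (hF : Continuous F) {V : Matrix (Fin d) (Fin d) ℝ}
    (hV : V ∈ Matrix.orthogonalGroup (Fin d) ℝ) :
    ∫ P, F (Vᵀ * P * V) ∂(sigmaMeasure l d) = ∫ P, F P ∂(sigmaMeasure l d) := by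
  rw [integral_sigmaMeasure hF, integral_sigmaMeasure (F := fun P => F (Vᵀ * P * V))
    (hF.comp (by fun_prop)), ← integral_mul_left_eq_self (fun O => F (conjDiag l d O))
      (⟨Vᵀ, transpose_mem hV⟩ : Matrix.orthogonalGroup (Fin d) ℝ)]
  refine integral_congr_ae (Filter.Eventually.of_forall fun O => ?_)
  simp [conjDiag, mul_assoc]

/-- The second moments of `σ_{λ,d}` along orthonormal pairs. -/
lemma exists_sigma_second_moments (hkd : k < d) (hk : 1 ≤ k) (l : Fin k → ℝ) :
    ∃ α γ e : ℝ, (∀ u v : Fin d → ℝ, u ⬝ᵥ u = 1 → v ⬝ᵥ v = 1 → u ⬝ᵥ v = 0 →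
      ∫ P, form P u u ^ 2 ∂(sigmaMeasure l d) = α ∧
      ∫ P, form P u u * form P v v ∂(sigmaMeasure l d) = γ ∧
      ∫ P, form P u v ^ 2 ∂(sigmaMeasure l d) = e) := by
  let i0 : Fin d := ⟨0, by omega⟩
  let i1 : Fin d := ⟨1, by omega⟩
  have hne : i0 ≠ i1 := by simp [i0, i1, Fin.ext_iff]
  refine ⟨∫ P, form P (Pi.single i0 1) (Pi.single i0 1) ^ 2 ∂(sigmaMeasure l d),
    ∫ P, form P (Pi.single i0 1) (Pi.single i0 1) * form P (Pi.single i1 1) (Pi.single i1 1)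
      ∂(sigmaMeasure l d),
    ∫ P, form P (Pi.single i0 1) (Pi.single i1 1) ^ 2 ∂(sigmaMeasure l d), ?_⟩
  intro u v hu hv huv
  obtain ⟨V, hV, h1, h2⟩ := exists_orthogonal_mulVec_pair_eq hu hv huv
    (u' := Pi.single i0 1) (v' := Pi.single i1 1) (by simp) (by simp) (by simp [hne.symm])
  refine ⟨?_, ?_, ?_⟩
  · rw [← integral_sigmaMeasure_conj (F := fun P => form P u u ^ 2) (by fun_prop) hV]
    simp [form_conj, h1]
  · rw [← integral_sigmaMeasure_conj (F := fun P => form P u u * form P v v) (by fun_prop) hV]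
    simp [form_conj, h1, h2]
  · rw [← integral_sigmaMeasure_conj (F := fun P => form P u v ^ 2) (by fun_prop) hV]
    simp [form_conj, h1, h2]

lemma transpose_apply_dotProduct {V : Matrix (Fin d) (Fin d) ℝ}
    (hV : V ∈ Matrix.orthogonalGroup (Fin d) ℝ) (a b : Fin d) :
    Vᵀ a ⬝ᵥ Vᵀ b = if a = b then 1 else 0 := by
  have h := congrFun (congrFun (transpose_mul_self_of_mem hV) a) b
  rw [mul_apply, one_apply] at h
  exact h

/-- By invariance the second moment equals `(α - γ) ∑ w_a² + γ (∑ w_a)²` with `γ ≥ 0`. Three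
relations determine `α - γ`: the Frobenius norm and the trace are constant on `𝒢_{λ,d}`, and a
rotation by 45 degrees gives `α - γ = 2e`. -/
lemma sum_form_sq_le_sigma_second_moment (hkd : k < d) (hk : 1 ≤ k) (l : Fin k → ℝ)
    (hl : ∀ i, 0 < l i) {V : Matrix (Fin d) (Fin d) ℝ}
    (hV : V ∈ Matrix.orthogonalGroup (Fin d) ℝ) (w : Fin d → ℝ) :
    (∑ i, l i ^ 2) / (k * d ^ 2) * ∑ a, w a ^ 2 ≤
      ∫ P, (∑ a, w a * form P (Vᵀ a) (Vᵀ a)) ^ 2 ∂(sigmaMeasure l d) := by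
  obtain ⟨α, γ, e, h⟩ := exists_sigma_second_moments (d := d) hkd hk l
  have hint : ∀ {F : Matrix (Fin d) (Fin d) ℝ → ℝ}, Continuous F →
      Integrable F (sigmaMeasure l d) := fun hF => integrable_of_continuous
        (ae_sigmaMeasure_mem l d) hF
  let i0 : Fin d := ⟨0, by omega⟩
  let i1 : Fin d := ⟨1, by omega⟩
  have hne : i0 ≠ i1 := by simp [i0, i1, Fin.ext_iff]
  -- the values on coordinate vectors
  have hdiag : ∀ a : Fin d, ∫ P : Matrix (Fin d) (Fin d) ℝ, P a a ^ 2 ∂(sigmaMeasure l d) = α := by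
    intro a
    obtain ⟨b, hb⟩ : ∃ b : Fin d, b ≠ a := by
      rcases eq_or_ne a i0 with rfl | h0
      exacts [⟨i1, hne.symm⟩, ⟨i0, h0.symm⟩]
    have := (h (Pi.single a 1) (Pi.single b 1) (by simp) (by simp) (by simp [hb])).1
    simpa [form_single] using this
  have hoff : ∀ a b : Fin d, a ≠ b →
      ∫ P : Matrix (Fin d) (Fin d) ℝ, P a a * P b b ∂(sigmaMeasure l d) = γ ∧
      ∫ P : Matrix (Fin d) (Fin d) ℝ, P a b ^ 2 ∂(sigmaMeasure l d) = e := by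
    intro a b hab
    have := (h (Pi.single a 1) (Pi.single b 1) (by simp) (by simp) (by simp [hab.symm])).2
    simpa [form_single] using this
  have hcard : ∀ (p q : ℝ), ∑ a : Fin d, ∑ b : Fin d, (if a = b then p else q) =
      d * p + d * (d - 1) * q := by
    intro p q
    have : ∀ a b : Fin d, (if a = b then p else q) = q + if a = b then p - q else 0 := by
      intro a b
      split_ifs <;> ring
    simp only [this, Finset.sum_add_distrib, Finset.sum_ite_eq, Finset.mem_univ, if_true,
      Finset.sum_const, Finset.card_univ, Fintype.card_fin, nsmul_eq_mul]
    ring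
  have e1 : (d : ℝ) * α + d * (d - 1) * e = ∑ i, l i ^ 2 := by
    rw [← hcard]
    have h1 : ∫ P : Matrix (Fin d) (Fin d) ℝ, ∑ a, ∑ b, P a b ^ 2 ∂(sigmaMeasure l d) =
        ∑ i, l i ^ 2 := by
      rw [integral_congr_ae ((ae_sigmaMeasure_mem l d).mono fun P hP =>
        sum_entry_sq_of_mem hkd hP)]
      simp
    rw [← h1, integral_finsetSum _ fun a _ => hint (by fun_prop)]
    refine Finset.sum_congr rfl fun a _ => ?_
    rw [integral_finsetSum _ fun b _ => hint (by fun_prop)]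
    refine Finset.sum_congr rfl fun b _ => ?_
    split_ifs with hab
    · rw [← hab, hdiag]
    · rw [(hoff a b hab).2]
  have e2 : (d : ℝ) * α + d * (d - 1) * γ = (∑ i, l i) ^ 2 := by
    rw [← hcard]
    have h1 : ∫ P : Matrix (Fin d) (Fin d) ℝ, ∑ a, ∑ b, P a a * P b b ∂(sigmaMeasure l d) =
        (∑ i, l i) ^ 2 := by
      have : ∀ᵐ P ∂(sigmaMeasure l d), ∑ a, ∑ b, P a a * P b b = (∑ i, l i) ^ 2 := by
        filter_upwards [ae_sigmaMeasure_mem l d] with P hP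
        rw [← trace_of_mem hkd hP, sq, trace, Finset.sum_mul_sum]
        rfl
      rw [integral_congr_ae this]
      simp
    rw [← h1, integral_finsetSum _ fun a _ => hint (by fun_prop)]
    refine Finset.sum_congr rfl fun a _ => ?_
    rw [integral_finsetSum _ fun b _ => hint (by fun_prop)]
    refine Finset.sum_congr rfl fun b _ => ?_
    split_ifs with hab
    · rw [← hab, ← hdiag a]
      exact integral_congr_ae (Filter.Eventually.of_forall fun P => by simp [sq])
    · rw [(hoff a b hab).1]
  -- rotation by 45 degrees
  have e3 : 4 * e = 2 * α - 2 * γ := by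
    set u : Fin d → ℝ := Pi.single i0 1
    set v : Fin d → ℝ := Pi.single i1 1
    have huu : u ⬝ᵥ u = 1 := by simp [u]
    have hvv : v ⬝ᵥ v = 1 := by simp [v]
    have huv : u ⬝ᵥ v = 0 := by simp [u, v, hne.symm]
    have hvu : v ⬝ᵥ u = 0 := by rw [dotProduct_comm, huv]
    set c : ℝ := (√2)⁻¹
    have hc : c * c = 1 / 2 := by
      rw [← mul_inv, Real.mul_self_sqrt (by norm_num)]
      norm_num
    have hrot := (h (c • (u + v)) (c • (u - v))
      (by simp [huu, hvv, huv, hvu]; linarith)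
      (by simp [huu, hvv, huv, hvu]; linarith)
      (by simp [huu, hvv, huv, hvu])).2.2
    have hcongr : ∀ᵐ P ∂(sigmaMeasure l d), form P (c • (u + v)) (c • (u - v)) ^ 2 =
        1 / 4 * (form P u u ^ 2 - 2 * (form P u u * form P v v) + form P v v ^ 2) := by
      filter_upwards [ae_sigmaMeasure_mem l d] with P hP
      rw [form_smul_left, form_smul_right, form_add_left, form_sub_right, form_sub_right,
        form_comm_of_mem hP v u, ← mul_assoc, hc]
      ring
    have i1 := hint (F := fun P => form P u u ^ 2) (by fun_prop)
    have i2 := hint (F := fun P => form P v v ^ 2) (by fun_prop)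
    have i3 := hint (F := fun P => form P u u * form P v v) (by fun_prop)
    have i4 := hint (F := fun P => form P u u ^ 2 - 2 * (form P u u * form P v v)) (by fun_prop)
    rw [integral_congr_ae hcongr, integral_const_mul, integral_add i4 i2,
      integral_sub i1 (i3.const_mul 2), integral_const_mul, (h u v huu hvv huv).1,
      (h u v huu hvv huv).2.1, (h v u hvv huu hvu).1] at hrot
    linarith
  have hγ : 0 ≤ γ := by
    rw [← (hoff i0 i1 hne).1]
    refine integral_nonneg_of_ae ?_
    filter_upwards [ae_sigmaMeasure_mem l d] with P hP
    have h0 := form_self_nonneg hl hP (Pi.single i0 1)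
    have h1 := form_self_nonneg hl hP (Pi.single i1 1)
    rw [form_single] at h0 h1
    exact mul_nonneg h0 h1
  have hdR : (k : ℝ) + 1 ≤ d := by exact_mod_cast hkd
  have hkR : (1 : ℝ) ≤ k := by exact_mod_cast hk
  have hL : 0 ≤ ∑ i, l i ^ 2 := Finset.sum_nonneg fun i _ => sq_nonneg _
  have hcs : (∑ i, l i) ^ 2 ≤ k * ∑ i, l i ^ 2 := by
    have := sq_sum_le_card_mul_sum_sq (s := Finset.univ) (f := l)
    simpa using this
  have hαγ : (∑ i, l i ^ 2) / (k * d ^ 2) ≤ α - γ := by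
    have e4 : d * (∑ i, l i ^ 2) - (∑ i, l i) ^ 2 = d * (d - 1) * (d + 2) * e := by
      have : γ = α - 2 * e := by linarith
      rw [← e1, ← e2, this]
      ring
    have hd0 : (0 : ℝ) < d := by linarith
    have hd1 : (0 : ℝ) < (d : ℝ) - 1 := by linarith
    have h5 : ((d : ℝ) - 1) * (∑ i, l i ^ 2) ≤ k * (d * (d - 1) * (d + 2) * e) := by
      rw [← e4]
      -- Equivalent to `(k - 1)(d - k - 1) ≥ 0`; with `(∑ l)² ≤ k ∑ l²` it gives a lower bound for
      -- `e` of order `d⁻²`.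
      have h6 : ((d : ℝ) - 1) ≤ k * (d - k) := by nlinarith
      have h7 := mul_le_mul_of_nonneg_right h6 hL
      have h8 := mul_le_mul_of_nonneg_left hcs (show (0 : ℝ) ≤ k by linarith)
      nlinarith
    have h9 : (∑ i, l i ^ 2) ≤ k * (d * (d + 2) * e) := by
      refine le_of_mul_le_mul_left (h5.trans (le_of_eq ?_)) hd1
      ring
    have he0 : 0 ≤ e := by
      rw [← (hoff i0 i1 hne).2]
      exact integral_nonneg fun P => sq_nonneg _
    rw [div_le_iff₀ (by positivity), show α - γ = 2 * e by linarith]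
    refine h9.trans ?_
    have : (d : ℝ) * (d + 2) ≤ 2 * d ^ 2 := by nlinarith
    have h10 := mul_le_mul_of_nonneg_right this (show 0 ≤ k * e by positivity)
    nlinarith
  have hsq : ∀ P : Matrix (Fin d) (Fin d) ℝ, (∑ a, w a * form P (Vᵀ a) (Vᵀ a)) ^ 2 =
      ∑ a, ∑ b, (w a * w b) * (form P (Vᵀ a) (Vᵀ a) * form P (Vᵀ b) (Vᵀ b)) := by
    intro P
    rw [sq, Finset.sum_mul_sum]
    exact Finset.sum_congr rfl fun a _ => Finset.sum_congr rfl fun b _ => by ring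
  have hval : ∫ P, (∑ a, w a * form P (Vᵀ a) (Vᵀ a)) ^ 2 ∂(sigmaMeasure l d) =
      (α - γ) * ∑ a, w a ^ 2 + γ * (∑ a, w a) ^ 2 := by
    simp_rw [hsq]
    have hc : ∀ a b : Fin d, Continuous fun P : Matrix (Fin d) (Fin d) ℝ =>
        (w a * w b) * (form P (Vᵀ a) (Vᵀ a) * form P (Vᵀ b) (Vᵀ b)) := fun a b =>
      continuous_const.mul ((continuous_form _ _).mul (continuous_form _ _))
    rw [integral_finsetSum _ fun a _ => hint (continuous_finsetSum _ fun b _ => hc a b)]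
    have hab : ∀ a b : Fin d, ∫ P, (w a * w b) * (form P (Vᵀ a) (Vᵀ a) * form P (Vᵀ b) (Vᵀ b))
        ∂(sigmaMeasure l d) = γ * (w a * w b) + if a = b then (α - γ) * w a ^ 2 else 0 := by
      intro a b
      rw [integral_const_mul]
      split_ifs with hab
      · subst hab
        obtain ⟨b, hb⟩ : ∃ b : Fin d, a ≠ b := by
          rcases eq_or_ne a i0 with rfl | h0
          exacts [⟨i1, hne⟩, ⟨i0, h0⟩]
        have := (h (Vᵀ a) (Vᵀ b) (by simp [transpose_apply_dotProduct hV])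
          (by simp [transpose_apply_dotProduct hV])
          (by simp [transpose_apply_dotProduct hV, hb])).1
        simp_rw [← sq, this]
        ring
      · have := (h (Vᵀ a) (Vᵀ b) (by simp [transpose_apply_dotProduct hV])
          (by simp [transpose_apply_dotProduct hV])
          (by simp [transpose_apply_dotProduct hV, hab])).2.1
        rw [this]
        ring
    simp_rw [integral_finsetSum _ fun b _ => hint (hc _ b), hab, Finset.sum_add_distrib,
      Finset.sum_ite_eq, Finset.mem_univ, if_true, ← Finset.mul_sum, ← Finset.sum_mul]
    ring
  rw [hval]
  have := mul_le_mul_of_nonneg_right hαγ (Finset.sum_nonneg fun a (_ : a ∈ univ) => sq_nonneg (w a))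
  nlinarith [mul_nonneg hγ (sq_nonneg (∑ a, w a))]

/-- The second moment of `σ_{λ,d}` at a symmetric matrix dominates its action on a unit vector. -/
lemma mulVec_le_sigma_second_moment (hkd : k < d) (hk : 1 ≤ k) (l : Fin k → ℝ)
    (hl : ∀ i, 0 < l i) {Z : Matrix (Fin d) (Fin d) ℝ} (hZ : Z.IsSymm) {x : Fin d → ℝ}
    (hx : x ⬝ᵥ x = 1) :
    (∑ i, l i ^ 2) / (k * d ^ 2) * ((Z *ᵥ x) ⬝ᵥ (Z *ᵥ x)) ≤
      ∫ P, hsInner P Z ^ 2 ∂(sigmaMeasure l d) := by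
  obtain ⟨V, hV, w, rfl⟩ := exists_orthogonal_diagonalization hZ
  simp_rw [hsInner_conj_diagonal]
  refine le_trans (mul_le_mul_of_nonneg_left ?_ (by positivity))
    (sum_form_sq_le_sigma_second_moment hkd hk l hl hV w)
  rw [← mulVec_mulVec, ← mulVec_mulVec, mulVec_dotProduct_mulVec_of_mem hV]
  simp only [dotProduct, mulVec_diagonal]
  rw [← mulVec_dotProduct_mulVec_of_mem (transpose_mem hV)] at hx
  refine Finset.sum_le_sum fun a _ => ?_
  have h1 : (Vᵀ *ᵥ x) a * (Vᵀ *ᵥ x) a ≤ 1 := by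
    rw [← hx]
    exact Finset.single_le_sum (f := fun a => (Vᵀ *ᵥ x) a * (Vᵀ *ᵥ x) a)
      (fun i _ => mul_self_nonneg _) (Finset.mem_univ a)
  nlinarith [mul_le_mul_of_nonneg_left h1 (sq_nonneg (w a))]

/-- The third moment of `σ_{λ,d}` at rank-one matrices. -/
lemma sigma_third_moment_le (hkd : k < d) (l : Fin k → ℝ) (hl : ∀ i, 0 < l i) (v : Fin d → ℝ) :
    ∫ P, form P v v ^ 3 ∂(sigmaMeasure l d) ≤ 15 * (∑ i, l i) ^ 3 / d ^ 3 * (v ⬝ᵥ v) ^ 3 := by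
  have hd : (0 : ℝ) < d := by exact_mod_cast (Nat.zero_le k).trans_lt hkd
  have hint : ∀ {F : Matrix (Fin d) (Fin d) ℝ → ℝ}, Continuous F →
      Integrable F (sigmaMeasure l d) := fun hF => integrable_of_continuous
        (ae_sigmaMeasure_mem l d) hF
  set c : ℝ := √((v ⬝ᵥ v) / d)
  have hc : c ^ 2 = (v ⬝ᵥ v) / d :=
    Real.sq_sqrt (div_nonneg (dotProduct_mul_self_nonneg v) hd.le)
  have hsgn : ∀ b, sgn b * sgn b = 1 := fun b => by cases b <;> simp [sgn]
  -- The factor `c` gives the scaled sign vectors the norm of `v`, so invariance allows `v` to be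
  -- replaced by any of them. Averaging over the signs then bounds the integrand pointwise in `P`.
  have key : ∀ ξ : Fin d → Bool, ∫ P, form P v v ^ 3 ∂(sigmaMeasure l d) =
      ∫ P, form P (c • fun i => sgn (ξ i)) (c • fun i => sgn (ξ i)) ^ 3 ∂(sigmaMeasure l d) := by
    intro ξ
    obtain ⟨V, hV, h1, -⟩ := exists_orthogonal_mulVec_eq v (c • fun i => sgn (ξ i)) (by
      have : (fun i => sgn (ξ i)) ⬝ᵥ (fun i => sgn (ξ i)) = (d : ℝ) := by
        simp [dotProduct, hsgn]
      rw [smul_dotProduct, dotProduct_smul, this, smul_eq_mul, smul_eq_mul, ← mul_assoc, ← sq, hc]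
      field_simp)
    rw [← integral_sigmaMeasure_conj (F := fun P => form P v v ^ 3) (by fun_prop) hV]
    simp [form_conj, h1]
  have havg : ∫ P, form P v v ^ 3 ∂(sigmaMeasure l d) = ∫ P, 𝔼 ξ : Fin d → Bool,
      form P (c • fun i => sgn (ξ i)) (c • fun i => sgn (ξ i)) ^ 3 ∂(sigmaMeasure l d) := by
    simp_rw [Fintype.expect_eq_sum_div_card]
    rw [integral_div, integral_finsetSum _ fun ξ _ => hint (by fun_prop)]
    simp_rw [← key]
    simp
  rw [havg]
  have hbd : ∀ᵐ P ∂(sigmaMeasure l d), 𝔼 ξ : Fin d → Bool,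
      form P (c • fun i => sgn (ξ i)) (c • fun i => sgn (ξ i)) ^ 3 ≤
        15 * (∑ i, l i) ^ 3 / d ^ 3 * (v ⬝ᵥ v) ^ 3 := by
    filter_upwards [ae_sigmaMeasure_mem l d] with P hP
    obtain ⟨V, hV, rfl⟩ := exists_of_mem_measurementSet hP
    have h := expect_weighted_sq_pow_three_le (spectrumVec l d) (spectrumVec_nonneg hl)
      (fun i => Vᵀ i) 1 (fun i => by
        have := transpose_apply_dotProduct hV i i
        rw [if_pos rfl] at this
        refine le_of_eq ?_
        rw [← this]
        simp [dotProduct, sq])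
    have h2 : ∀ ξ : Fin d → Bool, form (V * diagonal (spectrumVec l d) * Vᵀ)
        (c • fun i => sgn (ξ i)) (c • fun i => sgn (ξ i)) ^ 3 =
        (c ^ 2) ^ 3 * (∑ i, spectrumVec l d i * signSum (Vᵀ i) ξ ^ 2) ^ 3 := by
      intro ξ
      rw [form_smul_left, form_smul_right, ← mul_assoc, ← sq, mul_pow, form_conj_diagonal]
      congr 2
      refine Finset.sum_congr rfl fun i _ => ?_
      have : (Vᵀ *ᵥ fun i => sgn (ξ i)) i = signSum (Vᵀ i) ξ := by
        simp [mulVec, dotProduct, signSum, mul_comm]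
      rw [this, sq]
    simp_rw [h2]
    rw [← Finset.mul_expect, hc]
    rw [sum_spectrumVec hkd l (fun x => x) rfl] at h
    refine (mul_le_mul_of_nonneg_left h (pow_nonneg (div_nonneg
      (dotProduct_mul_self_nonneg v) hd.le) 3)).trans (le_of_eq ?_)
    field_simp
  refine (integral_mono_ae (hint ?_) (integrable_const _) hbd).trans (by simp)
  simp_rw [Fintype.expect_eq_sum_div_card]
  fun_prop

end Haar

/-! ### Moment bounds under strength three -/

section Law

variable {k d : ℕ} {l : Fin k → ℝ} {ν : Measure (Matrix (Fin d) (Fin d) ℝ)}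

lemma isSymm_vecMulVec (v : Fin d → ℝ) : (vecMulVec v v).IsSymm := transpose_vecMulVec v v

/-- Strength three determines the second moments, because the trace is constant on `𝒢_{λ,d}`. -/
lemma second_moment_eq_of_third (hk : 1 ≤ k) (hkd : k < d) (hl : ∀ i, 0 < l i)
    [IsProbabilityMeasure ν] (hν : ∀ᵐ P ∂ν, P ∈ measurementSet l d)
    (h3 : ∀ X : Matrix (Fin d) (Fin d) ℝ, X.IsSymm →
      ∫ P, hsInner P X ^ 3 ∂ν = ∫ P, hsInner P X ^ 3 ∂(sigmaMeasure l d))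
    {Z : Matrix (Fin d) (Fin d) ℝ} (hZ : Z.IsSymm) :
    ∫ P, hsInner P Z ^ 2 ∂ν = ∫ P, hsInner P Z ^ 2 ∂(sigmaMeasure l d) := by
  have hL : 0 < ∑ i, l i :=
    Finset.sum_pos (fun i _ => hl i) ⟨⟨0, hk⟩, Finset.mem_univ _⟩
  set L := ∑ i, l i with hLdef
  -- With `a = ⟨P, Z⟩` and `⟨P, 1⟩ = L`, this is `(a + L)³ - (a - L)³ = 6La² + 2L³`.
  have key : ∀ (ρ : Measure (Matrix (Fin d) (Fin d) ℝ)) [IsProbabilityMeasure ρ],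
      (∀ᵐ P ∂ρ, P ∈ measurementSet l d) →
      ∫ P, hsInner P (Z + 1) ^ 3 ∂ρ - ∫ P, hsInner P (Z - 1) ^ 3 ∂ρ =
        6 * L * ∫ P, hsInner P Z ^ 2 ∂ρ + 2 * L ^ 3 := by
    intro ρ _ hρ
    have hint : ∀ {F : Matrix (Fin d) (Fin d) ℝ → ℝ}, Continuous F → Integrable F ρ :=
      fun hF => integrable_of_continuous hρ hF
    rw [← integral_sub (hint (by fun_prop)) (hint (by fun_prop))]
    have : ∀ᵐ P ∂ρ, hsInner P (Z + 1) ^ 3 - hsInner P (Z - 1) ^ 3 =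
        6 * L * hsInner P Z ^ 2 + 2 * L ^ 3 := by
      filter_upwards [hρ] with P hP
      rw [hsInner_add_right, hsInner_sub_right, hsInner_one_right, trace_of_mem hkd hP]
      ring
    rw [integral_congr_ae this, integral_add (hint (by fun_prop)) (integrable_const _),
      integral_const_mul]
    simp
  have h1 := key ν hν
  have h2 := key (sigmaMeasure l d) (ae_sigmaMeasure_mem l d)
  rw [h3 _ (hZ.add isSymm_one), h3 _ (hZ.sub isSymm_one), h2] at h1
  have h4 : 6 * L * ∫ P, hsInner P Z ^ 2 ∂(sigmaMeasure l d) = 6 * L * ∫ P, hsInner P Z ^ 2 ∂ν := by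
    linarith
  exact (mul_left_cancel₀ (by positivity) h4).symm

lemma third_moment_le (hkd : k < d) (hl : ∀ i, 0 < l i)
    (h3 : ∀ X : Matrix (Fin d) (Fin d) ℝ, X.IsSymm →
      ∫ P, hsInner P X ^ 3 ∂ν = ∫ P, hsInner P X ^ 3 ∂(sigmaMeasure l d)) (v : Fin d → ℝ) :
    ∫ P, (d * form P v v) ^ 3 ∂ν ≤ 15 * (∑ i, l i) ^ 3 * (v ⬝ᵥ v) ^ 3 := by
  have hd : (0 : ℝ) < d := by exact_mod_cast (Nat.zero_le k).trans_lt hkd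
  have h := h3 _ (isSymm_vecMulVec v)
  simp only [hsInner_vecMulVec] at h
  simp_rw [mul_pow, integral_const_mul, h]
  refine (mul_le_mul_of_nonneg_left (sigma_third_moment_le hkd l hl v)
    (by positivity)).trans (le_of_eq ?_)
  field_simp

/-- Truncated first moments at rank-one matrices. -/
lemma integral_min_form_le (hkd : k < d) (hl : ∀ i, 0 < l i)
    [IsProbabilityMeasure ν] (hν : ∀ᵐ P ∂ν, P ∈ measurementSet l d)
    (h3 : ∀ X : Matrix (Fin d) (Fin d) ℝ, X.IsSymm →
      ∫ P, hsInner P X ^ 3 ∂ν = ∫ P, hsInner P X ^ 3 ∂(sigmaMeasure l d))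
    {g : Fin d → ℝ} (hg : g ⬝ᵥ g ≤ 3) (K : ℝ) :
    ∫ P, min |d * form P g g| K ∂ν ≤ 1 + 405 * (∑ i, l i) ^ 3 := by
  have hL : 0 ≤ ∑ i, l i := Finset.sum_nonneg fun i _ => (hl i).le
  have hint : ∀ {F : Matrix (Fin d) (Fin d) ℝ → ℝ}, Continuous F → Integrable F ν :=
      fun hF => integrable_of_continuous hν hF
  have hbd : ∀ᵐ P ∂ν, min |d * form P g g| K ≤ 1 + (d * form P g g) ^ 3 := by
    filter_upwards [hν] with P hP
    have h0 : 0 ≤ d * form P g g := mul_nonneg (Nat.cast_nonneg d) (form_self_nonneg hl hP g)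
    refine (min_le_left _ _).trans ?_
    rw [abs_of_nonneg h0]
    nlinarith [sq_nonneg ((d * form P g g) - 1)]
  refine (integral_mono_ae (hint (by fun_prop)) (hint (by fun_prop)) hbd).trans ?_
  rw [integral_add (integrable_const _) (hint (by fun_prop))]
  have h1 := third_moment_le hkd hl h3 g
  have h2 : (g ⬝ᵥ g) ^ 3 ≤ 3 ^ 3 := pow_le_pow_left₀ (dotProduct_mul_self_nonneg g) hg 3
  have h4 := mul_le_mul_of_nonneg_left h2 (show 0 ≤ 15 * (∑ i, l i) ^ 3 by positivity)
  simp only [integral_const, probReal_univ, one_smul]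
  linarith

/-- The matrix `x z* + z x* + r⁻¹ ∑ g_l g_l*`. -/
noncomputable def descentMatrix {r : ℕ} (x z : Fin d → ℝ) (g : Fin r → Fin d → ℝ) :
    Matrix (Fin d) (Fin d) ℝ :=
  vecMulVec x z + vecMulVec z x + (1 / (r : ℝ)) • ∑ a, vecMulVec (g a) (g a)

variable {r : ℕ}

lemma isSymm_descentMatrix (x z : Fin d → ℝ) (g : Fin r → Fin d → ℝ) :
    (descentMatrix x z g).IsSymm := by
  simp only [IsSymm, descentMatrix, transpose_add, transpose_vecMulVec, transpose_smul,
    transpose_sum, add_comm (vecMulVec x z)]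

lemma hsInner_descentMatrix (P : Matrix (Fin d) (Fin d) ℝ) (x z : Fin d → ℝ)
    (g : Fin r → Fin d → ℝ) :
    hsInner P (descentMatrix x z g) =
      form P x z + form P z x + 1 / r * ∑ a, form P (g a) (g a) := by
  simp only [descentMatrix, hsInner_add_right, hsInner_smul_right, hsInner_sum_right,
    hsInner_vecMulVec]

/-- Since each `g a` is orthogonal to `x`, the matrix sends `x` to `(z ⬝ᵥ x) • x + z`; the rank-one
terms cannot cancel the part carried by `z`. -/
lemma le_descentMatrix_mulVec {x z : Fin d → ℝ} (hx : x ⬝ᵥ x = 1) {g : Fin r → Fin d → ℝ}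
    (hg : ∀ a, g a ⬝ᵥ x = 0) :
    z ⬝ᵥ z ≤ (descentMatrix x z g *ᵥ x) ⬝ᵥ (descentMatrix x z g *ᵥ x) := by
  have h : descentMatrix x z g *ᵥ x = (z ⬝ᵥ x) • x + z := by
    rw [descentMatrix, add_mulVec, add_mulVec, smul_mulVec, sum_mulVec]
    simp [vecMulVec_mulVec, hg, hx]
  rw [h]
  simp only [add_dotProduct, dotProduct_add, smul_dotProduct, dotProduct_smul, hx, smul_eq_mul,
    dotProduct_comm x z]
  nlinarith [sq_nonneg (z ⬝ᵥ x)]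

/-- The pairing is dominated by a sum of three nonnegative terms, and `(A + B + C)³ ≤ 9(A³ + B³ +
C³)`. The squared norms 1, 4 and 3 give `9 * 15 * (1 + 64 + 27) = 12420`; the average over the `g a`
costs no factor `r`, by Jensen. -/
lemma hsInner_descentMatrix_third_moment_le (hkd : k < d) (hl : ∀ i, 0 < l i)
    [IsProbabilityMeasure ν] (hν : ∀ᵐ P ∂ν, P ∈ measurementSet l d)
    (h3 : ∀ X : Matrix (Fin d) (Fin d) ℝ, X.IsSymm →
      ∫ P, hsInner P X ^ 3 ∂ν = ∫ P, hsInner P X ^ 3 ∂(sigmaMeasure l d))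
    (hr : 0 < r) {x z : Fin d → ℝ} (hx : x ⬝ᵥ x = 1) (hz : z ⬝ᵥ z ≤ 4)
    {g : Fin r → Fin d → ℝ} (hg : ∀ a, g a ⬝ᵥ g a ≤ 3) :
    ∫ P, |d * hsInner P (descentMatrix x z g)| ^ 3 ∂ν ≤ 12420 * (∑ i, l i) ^ 3 := by
  have hL : 0 ≤ ∑ i, l i := Finset.sum_nonneg fun i _ => (hl i).le
  have hrR : (0 : ℝ) < r := by exact_mod_cast hr
  have hint : ∀ {F : Matrix (Fin d) (Fin d) ℝ → ℝ}, Continuous F → Integrable F ν :=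
      fun hF => integrable_of_continuous hν hF
  have hbd : ∀ᵐ P ∂ν, |d * hsInner P (descentMatrix x z g)| ^ 3 ≤
      9 * (d * form P x x) ^ 3 + 9 * (d * form P z z) ^ 3 +
        9 / r * ∑ a, (d * form P (g a) (g a)) ^ 3 := by
    filter_upwards [hν] with P hP
    have hq : ∀ v, 0 ≤ d * form P v v := fun v =>
      mul_nonneg (Nat.cast_nonneg d) (form_self_nonneg hl hP v)
    set A := (d : ℝ) * form P x x with hA
    set B := (d : ℝ) * form P z z with hB
    set C := ∑ a, (1 / (r : ℝ)) * (d * form P (g a) (g a)) with hC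
    have hA0 : 0 ≤ A := hq x
    have hB0 : 0 ≤ B := hq z
    have hC0 : 0 ≤ C := Finset.sum_nonneg fun a _ => mul_nonneg (by positivity) (hq _)
    have h1 : |d * hsInner P (descentMatrix x z g)| ≤ A + B + C := by
      have : d * hsInner P (descentMatrix x z g) = d * (2 * form P x z) + C := by
        rw [hsInner_descentMatrix, form_comm_of_mem hP z x, hC, ← Finset.mul_sum, ← Finset.mul_sum]
        ring
      rw [this]
      refine (abs_add_le _ _).trans ?_
      rw [abs_of_nonneg hC0, abs_mul, abs_mul, Nat.abs_cast, abs_two]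
      have := mul_le_mul_of_nonneg_left (form_mul_self_le hl hP x z) (Nat.cast_nonneg (α := ℝ) d)
      rw [mul_add] at this
      linarith
    have h2 : C ^ 3 ≤ 1 / r * ∑ a, (d * form P (g a) (g a)) ^ 3 := by
      have := weighted_sum_pow_three_le (fun _ : Fin r => 1 / (r : ℝ)) (fun _ => by positivity)
        (fun a => d * form P (g a) (g a)) (fun a => hq _)
      simp only [Finset.sum_const, Finset.card_univ, Fintype.card_fin, nsmul_eq_mul,
        mul_one_div_cancel hrR.ne', one_pow, one_mul] at this
      rw [hC, Finset.mul_sum]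
      exact this
    have h5 : (A + B + C) ^ 3 ≤ 9 * A ^ 3 + 9 * B ^ 3 + 9 * C ^ 3 := by
      have := weighted_sum_pow_three_le (fun _ : Fin 3 => (1 : ℝ)) (fun _ => zero_le_one)
        ![A, B, C] (fun i => by fin_cases i <;> simpa)
      simp only [Fin.sum_univ_three, one_mul, cons_val_zero, cons_val_one] at this
      rw [show ![A, B, C] 2 = C from rfl] at this
      linarith
    refine (pow_le_pow_left₀ (abs_nonneg _) h1 3).trans (h5.trans ?_)
    have : 9 / (r : ℝ) * ∑ a, (d * form P (g a) (g a)) ^ 3 =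
      9 * (1 / r * ∑ a, (d * form P (g a) (g a)) ^ 3) := by ring
    rw [this]
    linarith
  refine (integral_mono_ae (hint (by fun_prop)) (hint (by fun_prop)) hbd).trans ?_
  rw [integral_add (hint (by fun_prop)) (hint (by fun_prop)),
    integral_add (hint (by fun_prop)) (hint (by fun_prop)), integral_const_mul, integral_const_mul,
    integral_const_mul, integral_finsetSum _ fun a _ => hint (by fun_prop)]
  have hpos : 0 ≤ 15 * (∑ i, l i) ^ 3 := by positivity
  have hm : ∀ {v : Fin d → ℝ} {c : ℝ}, v ⬝ᵥ v ≤ c →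
      ∫ P, (d * form P v v) ^ 3 ∂ν ≤ 15 * (∑ i, l i) ^ 3 * c ^ 3 := fun {v c} h =>
    (third_moment_le hkd hl h3 v).trans (mul_le_mul_of_nonneg_left
      (pow_le_pow_left₀ (dotProduct_mul_self_nonneg v) h 3) hpos)
  have e1 := hm hx.le
  have e2 := hm hz
  have e3 : 9 / (r : ℝ) * ∑ a, ∫ P, (d * form P (g a) (g a)) ^ 3 ∂ν ≤
      9 * (15 * (∑ i, l i) ^ 3 * 3 ^ 3) := by
    refine (mul_le_mul_of_nonneg_left (Finset.sum_le_sum fun a _ => hm (hg a))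
      (by positivity)).trans (le_of_eq ?_)
    simp only [Finset.sum_const, Finset.card_univ, Fintype.card_fin, nsmul_eq_mul]
    field_simp
  linarith

/-- The truncated absolute moments at descent matrices are bounded below. -/
lemma le_integral_min_descentMatrix (hk : 1 ≤ k) (hkd : k < d) (hl : ∀ i, 0 < l i)
    [IsProbabilityMeasure ν] (hν : ∀ᵐ P ∂ν, P ∈ measurementSet l d)
    (h3 : ∀ X : Matrix (Fin d) (Fin d) ℝ, X.IsSymm →
      ∫ P, hsInner P X ^ 3 ∂ν = ∫ P, hsInner P X ^ 3 ∂(sigmaMeasure l d))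
    (hr : 0 < r) {x z : Fin d → ℝ} (hx : x ⬝ᵥ x = 1) (hz : z ⬝ᵥ z ≤ 4) (hz' : 1 / 4 ≤ z ⬝ᵥ z)
    {g : Fin r → Fin d → ℝ} (hg : ∀ a, g a ⬝ᵥ g a ≤ 3) (hgx : ∀ a, g a ⬝ᵥ x = 0)
    {κ M : ℝ} (hκ : κ = (∑ i, l i ^ 2) / k) (hM : M = 8 * (12420 * (∑ i, l i) ^ 3) / κ) :
    κ / (8 * M) ≤ ∫ P, min |d * hsInner P (descentMatrix x z g)| M ∂ν := by
  have hd : (0 : ℝ) < d := by exact_mod_cast (Nat.zero_le k).trans_lt hkd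
  have hkR : (0 : ℝ) < k := by exact_mod_cast hk
  have hne : (Finset.univ : Finset (Fin k)).Nonempty := ⟨⟨0, hk⟩, Finset.mem_univ _⟩
  have hL : 0 < ∑ i, l i := Finset.sum_pos (fun i _ => hl i) hne
  have hL2 : 0 < ∑ i, l i ^ 2 := Finset.sum_pos (fun i _ => pow_pos (hl i) 2) hne
  have hκ0 : 0 < κ := hκ ▸ div_pos hL2 hkR
  have hM0 : 0 < M := hM ▸ by positivity
  have hint : ∀ {F : Matrix (Fin d) (Fin d) ℝ → ℝ}, Continuous F → Integrable F ν :=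
      fun hF => integrable_of_continuous hν hF
  set Y := fun P => |d * hsInner P (descentMatrix x z g)| with hY
  have hYc : Continuous Y := by fun_prop
  -- This turns a lower second moment and an upper third moment into a lower truncated first moment.
  have hpt : ∀ P, Y P ^ 2 - 1 / M * Y P ^ 3 ≤ M * min (Y P) M := by
    intro P
    have h0 : 0 ≤ Y P := abs_nonneg _
    have hcube : Y P ^ 3 = Y P * Y P ^ 2 := by ring
    rcases le_total (Y P) M with h | h
    · rw [min_eq_left h]
      have : 0 ≤ 1 / M * Y P ^ 3 := by positivity
      nlinarith
    · rw [min_eq_right h]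
      have : Y P ^ 2 ≤ 1 / M * Y P ^ 3 := by
        rw [one_div, ← div_eq_inv_mul, le_div_iff₀ hM0, hcube, mul_comm (Y P)]
        exact mul_le_mul_of_nonneg_left h (sq_nonneg _)
      nlinarith
  have hI := integral_mono (hint (by fun_prop)) (hint (by fun_prop)) hpt
  rw [integral_sub (hint (by fun_prop)) (hint (by fun_prop)), integral_const_mul,
    integral_const_mul] at hI
  have hthird : ∫ P, Y P ^ 3 ∂ν ≤ 12420 * (∑ i, l i) ^ 3 :=
    hsInner_descentMatrix_third_moment_le hkd hl hν h3 hr hx hz hg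
  have hsecond : κ * (1 / 4) ≤ ∫ P, Y P ^ 2 ∂ν := by
    simp_rw [hY, sq_abs, mul_pow, integral_const_mul]
    rw [second_moment_eq_of_third hk hkd hl hν h3 (isSymm_descentMatrix x z g)]
    have h1 := mulVec_le_sigma_second_moment hkd hk l hl (isSymm_descentMatrix x z g) hx
    have h2 := hz'.trans (le_descentMatrix_mulVec (z := z) hx hgx)
    have h4 : (∑ i, l i ^ 2) / (k * d ^ 2) = κ / d ^ 2 := by rw [hκ, div_div]
    rw [h4] at h1
    have h5 := (mul_le_mul_of_nonneg_left h2 (show 0 ≤ κ / d ^ 2 by positivity)).trans h1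
    refine le_trans (le_of_eq ?_) (mul_le_mul_of_nonneg_left h5 (sq_nonneg (d : ℝ)))
    field_simp
  -- `M` is chosen so that the third-moment term consumes half of the second-moment bound `κ / 4`.
  have hMκ : 1 / M * (12420 * (∑ i, l i) ^ 3) = κ / 8 := by
    rw [hM]
    field_simp
  have h6 := mul_le_mul_of_nonneg_left hthird (show 0 ≤ 1 / M by positivity)
  rw [div_le_iff₀ (by positivity)]
  linarith

end Law

/-! ### The finite grid and the projection off the signal -/

section Grid

variable {d : ℕ}

/-- The points of the grid `(N⁻¹ ℤ ∩ [-2, 2])^d`. -/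
noncomputable def gridVec {N : ℕ} (a : Fin d → Fin (4 * N + 1)) (i : Fin d) : ℝ :=
  ((a i : ℕ) : ℝ) / N - 2

lemma exists_gridVec_close {N : ℕ} (hN : 0 < N) (u : Fin d → ℝ) (hu : ∀ i, |u i| ≤ 2) :
    ∃ a : Fin d → Fin (4 * N + 1),
      (gridVec a - u) ⬝ᵥ (gridVec a - u) ≤ d / (N : ℝ) ^ 2 := by
  have hNR : (0 : ℝ) < N := by exact_mod_cast hN
  have h0 : ∀ i, 0 ≤ (u i + 2) * N := fun i =>
    mul_nonneg (by linarith [(abs_le.1 (hu i)).1]) hNR.le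
  have hlt : ∀ i, ⌊(u i + 2) * N⌋₊ < 4 * N + 1 := by
    intro i
    rw [Nat.lt_succ_iff]
    refine Nat.floor_le_of_le ?_
    push_cast
    exact mul_le_mul_of_nonneg_right (by linarith [(abs_le.1 (hu i)).2]) hNR.le
  refine ⟨fun i => ⟨_, hlt i⟩, ?_⟩
  have hi : ∀ i, ((gridVec fun i => (⟨_, hlt i⟩ : Fin (4 * N + 1))) - u) i *
      ((gridVec fun i => (⟨_, hlt i⟩ : Fin (4 * N + 1))) - u) i ≤ 1 / (N : ℝ) ^ 2 := by
    intro i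
    have h1 := Nat.floor_le (h0 i)
    have h2 := Nat.lt_floor_add_one ((u i + 2) * N)
    simp only [Pi.sub_apply, gridVec]
    set y : ℝ := (⌊(u i + 2) * N⌋₊ : ℝ)
    have h3 : y / N - 2 - u i = -(((u i + 2) * N - y) / N) := by
      field_simp
      ring
    rw [h3, neg_mul_neg, ← sq, div_pow]
    gcongr
    exact pow_le_one₀ (by linarith) (by linarith)
  refine (Finset.sum_le_sum fun i _ => hi i).trans (le_of_eq ?_)
  simp
  ring

/-- The orthogonal projection of `g` onto the complement of the unit vector `x`. -/
def projCompl (x g : Fin d → ℝ) : Fin d → ℝ := g - (x ⬝ᵥ g) • x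

lemma projCompl_dotProduct {x : Fin d → ℝ} (hx : x ⬝ᵥ x = 1) (g : Fin d → ℝ) :
    projCompl x g ⬝ᵥ x = 0 := by
  simp [projCompl, hx, dotProduct_comm]

lemma projCompl_self_le {x : Fin d → ℝ} (hx : x ⬝ᵥ x = 1) (g : Fin d → ℝ) :
    projCompl x g ⬝ᵥ projCompl x g ≤ g ⬝ᵥ g := by
  simp only [projCompl, sub_dotProduct, dotProduct_sub, smul_dotProduct, dotProduct_smul, hx,
    smul_eq_mul, dotProduct_comm g x]
  nlinarith [sq_nonneg (x ⬝ᵥ g)]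

end Grid

/-! ### Concentration on the grid -/

section Sample

variable {k d n : ℕ}

/-- A sample of measurement matrices with the two counting estimates on the grid. -/
structure IsGoodSample (l : Fin k → ℝ) (x : Fin d → ℝ) (r N : ℕ) (β M B K : ℝ)
    (Q : Fin n → Matrix (Fin d) (Fin d) ℝ) : Prop where
  mem : ∀ j, Q j ∈ measurementSet l d
  lower : ∀ (z : Fin d → Fin (4 * N + 1)) (g : Fin r → Fin d → Fin (4 * N + 1)),
    gridVec z ⬝ᵥ gridVec z ≤ 4 → 1 / 4 ≤ gridVec z ⬝ᵥ gridVec z →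
    (∀ a, gridVec (g a) ⬝ᵥ gridVec (g a) ≤ 3) →
    n * (β - β / 2) < ∑ j, min |d * hsInner (Q j)
      (descentMatrix x (gridVec z) fun a => projCompl x (gridVec (g a)))| M
  upper : ∀ g : Fin d → Fin (4 * N + 1), gridVec g ⬝ᵥ gridVec g ≤ 3 →
    ∑ j, min |d * form (Q j) (gridVec g) (gridVec g)| K < 2 * B * n

variable {Ω₀ Ω : Type*} [MeasurableSpace Ω₀] {μ₀ : Measure Ω₀}
  [MeasurableSpace Ω] {μ : Measure Ω} [IsProbabilityMeasure μ]
  {P₀ : Ω₀ → Matrix (Fin d) (Fin d) ℝ} {P : Fin n → Ω → Matrix (Fin d) (Fin d) ℝ}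

/-- Hoeffding's inequality for the lower tail of a bounded statistic of the sample. -/
lemma measure_sum_le_le (hind : iIndepFun P μ) (hid : ∀ j, IdentDistrib (P j) P₀ μ μ₀)
    {F : Matrix (Fin d) (Fin d) ℝ → ℝ} (hF : Continuous F) {M b δ : ℝ} (hM : 0 < M) (hδ : 0 ≤ δ)
    (hF0 : ∀ X, 0 ≤ F X) (hFM : ∀ X, F X ≤ M) (hb : b ≤ ∫ X, F X ∂(μ₀.map P₀)) :
    μ.real {s | ∑ j, F (P j s) ≤ n * (b - δ)} ≤ Real.exp (-(2 * δ ^ 2 / M ^ 2 * n)) := by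
  have hm : ∀ j, ∫ s, F (P j s) ∂μ = ∫ X, F X ∂(μ₀.map P₀) := by
    intro j
    rw [← (hid j).map_eq, integral_map (hid j).aemeasurable_fst hF.aestronglyMeasurable]
  have hmeas : ∀ j, AEMeasurable (fun s => F (P j s)) μ := fun j =>
    hF.measurable.comp_aemeasurable (hid j).aemeasurable_fst
  have hsub : ∀ j, HasSubgaussianMGF (fun s => -(F (P j s) - ∫ s, F (P j s) ∂μ))
      ((‖M - 0‖₊ / 2) ^ 2) μ := fun j =>
    (hasSubgaussianMGF_of_mem_Icc (hmeas j)
      (Filter.Eventually.of_forall fun s => ⟨hF0 _, hFM _⟩)).neg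
  have hind' : iIndepFun (fun j s => -(F (P j s) - ∫ s, F (P j s) ∂μ)) μ :=
    hind.comp (fun j X => -(F X - ∫ s, F (P j s) ∂μ)) fun j => by
      have := hF.measurable
      fun_prop
  have h := HasSubgaussianMGF.measure_sum_ge_le_of_iIndepFun hind' (s := Finset.univ)
    (fun j _ => hsub j) (ε := n * δ) (by positivity)
  have hsubset : {s | ∑ j, F (P j s) ≤ n * (b - δ)} ⊆
      {s | n * δ ≤ ∑ j, -(F (P j s) - ∫ s, F (P j s) ∂μ)} := by
    intro s hs
    simp only [Set.mem_ofPred_eq, hm, neg_sub, Finset.sum_sub_distrib, Finset.sum_const,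
      Finset.card_univ, Fintype.card_fin, nsmul_eq_mul] at hs ⊢
    have := mul_le_mul_of_nonneg_left hb (Nat.cast_nonneg (α := ℝ) n)
    linarith
  refine (measureReal_mono hsubset).trans (h.trans (le_of_eq ?_))
  congr 1
  simp only [sub_zero, Finset.sum_const, Finset.card_univ, Fintype.card_fin, nsmul_eq_mul]
  push_cast
  rw [Real.norm_eq_abs, abs_of_pos hM]
  rcases Nat.eq_zero_or_pos n with rfl | hn
  · simp
  · have : (0 : ℝ) < n := by exact_mod_cast hn
    field_simp

/-- Hoeffding's inequality for each grid tuple, followed by a union bound. The lower estimate ranges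
over `r + 1` grid vectors, which gives the exponent `d * (r + 1)`; the upper estimate needs only one
vector and is absorbed by the factor 2. -/
lemma measure_not_isGoodSample_le [IsProbabilityMeasure μ₀] {l : Fin k → ℝ} (hk : 1 ≤ k) (hkd : k < d) (hl : ∀ i, 0 < l i)
    (h3 : IsRandomCubature l 3 μ₀ P₀) (hind : iIndepFun P μ)
    (hid : ∀ j, IdentDistrib (P j) P₀ μ μ₀) {x : Fin d → ℝ} (hx : x ⬝ᵥ x = 1) {r N : ℕ}
    (hr : 0 < r) {κ β M B K c : ℝ} (hκ : κ = (∑ i, l i ^ 2) / k)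
    (hM : M = 8 * (12420 * (∑ i, l i) ^ 3) / κ) (hβ : β = κ / (8 * M))
    (hB : B = 1 + 405 * (∑ i, l i) ^ 3) (hK : 0 < K) (hc1 : c ≤ 2 * (β / 2) ^ 2 / M ^ 2)
    (hc2 : c ≤ 2 * B ^ 2 / K ^ 2) :
    μ.real {s | ¬ IsGoodSample l x r N β M B K fun j => P j s} ≤
      2 * (4 * N + 1 : ℝ) ^ (d * (r + 1)) * Real.exp (-(c * n)) := by
  classical
  have hkR : (0 : ℝ) < k := by exact_mod_cast hk
  have hne : (Finset.univ : Finset (Fin k)).Nonempty := ⟨⟨0, hk⟩, Finset.mem_univ _⟩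
  have hL : 0 < ∑ i, l i := Finset.sum_pos (fun i _ => hl i) hne
  have hL2 : 0 < ∑ i, l i ^ 2 := Finset.sum_pos (fun i _ => pow_pos (hl i) 2) hne
  have hκ0 : 0 < κ := hκ ▸ div_pos hL2 hkR
  have hM0 : 0 < M := hM ▸ by positivity
  have hβ0 : 0 < β := hβ ▸ by positivity
  have hB0 : 0 < B := hB ▸ by positivity
  set ν := μ₀.map P₀ with hνdef
  have : IsProbabilityMeasure ν := Measure.isProbabilityMeasure_map h3.aemeasurable
  have hms : MeasurableSet (measurementSet l d) := (isCompact_measurementSet l d).measurableSet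
  have hν : ∀ᵐ X ∂ν, X ∈ measurementSet l d := (ae_map_iff h3.aemeasurable hms).2 h3.mem
  have hthird : ∀ X : Matrix (Fin d) (Fin d) ℝ, X.IsSymm →
      ∫ P, hsInner P X ^ 3 ∂ν = ∫ P, hsInner P X ^ 3 ∂(sigmaMeasure l d) := by
    intro X hX
    rw [hνdef, integral_map h3.aemeasurable
      (Continuous.aestronglyMeasurable (by fun_prop))]
    exact h3.moment_eq X hX
  have hmem : μ.real {s | ¬ ∀ j, P j s ∈ measurementSet l d} = 0 := by
    rw [measureReal_eq_zero_iff, ← ae_iff, ae_all_iff]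
    intro j
    refine (ae_map_iff (hid j).aemeasurable_fst hms).1 ?_
    rw [(hid j).map_eq]
    exact hν
  have hexp : ∀ {a : ℝ}, c ≤ a → Real.exp (-(a * n)) ≤ Real.exp (-(c * n)) := fun h =>
    Real.exp_le_exp.2 (neg_le_neg (mul_le_mul_of_nonneg_right h (Nat.cast_nonneg n)))
  let bad1 (p : (Fin d → Fin (4 * N + 1)) × (Fin r → Fin d → Fin (4 * N + 1))) : Set Ω :=
    {s | gridVec p.1 ⬝ᵥ gridVec p.1 ≤ 4 ∧ 1 / 4 ≤ gridVec p.1 ⬝ᵥ gridVec p.1 ∧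
      (∀ a, gridVec (p.2 a) ⬝ᵥ gridVec (p.2 a) ≤ 3) ∧
      ∑ j, min |d * hsInner (P j s)
        (descentMatrix x (gridVec p.1) fun a => projCompl x (gridVec (p.2 a)))| M ≤
        n * (β - β / 2)}
  let bad2 (g : Fin d → Fin (4 * N + 1)) : Set Ω :=
    {s | gridVec g ⬝ᵥ gridVec g ≤ 3 ∧
      2 * B * n ≤ ∑ j, min |d * form (P j s) (gridVec g) (gridVec g)| K}
  have hbad1 : ∀ p, μ.real (bad1 p) ≤ Real.exp (-(c * n)) := by
    intro p
    by_cases hp : gridVec p.1 ⬝ᵥ gridVec p.1 ≤ 4 ∧ 1 / 4 ≤ gridVec p.1 ⬝ᵥ gridVec p.1 ∧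
      ∀ a, gridVec (p.2 a) ⬝ᵥ gridVec (p.2 a) ≤ 3
    · refine (measureReal_mono (s₂ := {s | ∑ j, min |d * hsInner (P j s)
        (descentMatrix x (gridVec p.1) fun a => projCompl x (gridVec (p.2 a)))| M ≤
        n * (β - β / 2)}) fun s hs => hs.2.2.2).trans ?_
      refine (measure_sum_le_le hind hid (F := fun X => min |d * hsInner X
        (descentMatrix x (gridVec p.1) fun a => projCompl x (gridVec (p.2 a)))| M)
        (by fun_prop) hM0 (by positivity) (fun X => le_min (abs_nonneg _) hM0.le)
        (fun X => min_le_right _ _) ?_).trans (hexp hc1)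
      rw [hβ]
      exact le_integral_min_descentMatrix hk hkd hl hν hthird hr hx hp.1 hp.2.1
        (fun a => (projCompl_self_le hx _).trans (hp.2.2 a))
        (fun a => projCompl_dotProduct hx _) hκ hM
    · have : bad1 p = ∅ := Set.eq_empty_of_forall_notMem fun s hs => hp ⟨hs.1, hs.2.1, hs.2.2.1⟩
      rw [this]
      simp [Real.exp_nonneg]
  have hbad2 : ∀ g, μ.real (bad2 g) ≤ Real.exp (-(c * n)) := by
    intro g
    by_cases hg : gridVec g ⬝ᵥ gridVec g ≤ 3
    -- Reflection `y ↦ K - y` turns the upper tail into the lower tail already treated: the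
    -- truncated mean is at most `B`, and the threshold `2B` leaves a deviation of `B`.
    · refine (measureReal_mono (s₂ := {s | ∑ j, (K - min |d * form (P j s) (gridVec g) (gridVec g)| K)
        ≤ n * ((K - B) - B)}) fun s hs => ?_).trans ?_
      · have := hs.2
        simp only [Set.mem_ofPred_eq, Finset.sum_sub_distrib, Finset.sum_const, Finset.card_univ,
          Fintype.card_fin, nsmul_eq_mul]
        linarith
      refine (measure_sum_le_le hind hid (F := fun X =>
        K - min |d * form X (gridVec g) (gridVec g)| K)
        (by fun_prop) hK hB0.le (fun X => sub_nonneg.2 (min_le_right _ _))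
        (fun X => sub_le_self _ (le_min (abs_nonneg _) hK.le)) ?_).trans (hexp hc2)
      rw [integral_sub (integrable_const _) (integrable_of_continuous hν (by fun_prop))]
      have := integral_min_form_le hkd hl hν hthird hg K
      simp only [integral_const, probReal_univ, one_smul]
      linarith
    · have : bad2 g = ∅ := Set.eq_empty_of_forall_notMem fun s hs => hg hs.1
      rw [this]
      simp [Real.exp_nonneg]
  have hsub : {s | ¬ IsGoodSample l x r N β M B K fun j => P j s} ⊆
      {s | ¬ ∀ j, P j s ∈ measurementSet l d} ∪ ((⋃ p, bad1 p) ∪ ⋃ g, bad2 g) := by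
    intro s hs
    by_contra hcon
    simp only [Set.mem_union, Set.mem_iUnion, not_or, not_exists, Set.mem_ofPred_eq,
      not_not] at hcon
    refine hs ⟨hcon.1, fun z g h1 h2 h4 => ?_, fun g hg => ?_⟩
    · exact not_le.1 fun h => hcon.2.1 (z, g) ⟨h1, h2, h4, h⟩
    · exact not_le.1 fun h => hcon.2.2 g ⟨hg, h⟩
  have hN1 : (1 : ℝ) ≤ 4 * N + 1 := by
    have : (0 : ℝ) ≤ N := Nat.cast_nonneg N
    linarith
  have hu1 : μ.real (⋃ p, bad1 p) ≤ (4 * N + 1 : ℝ) ^ (d * (r + 1)) * Real.exp (-(c * n)) := by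
    refine (measureReal_iUnion_fintype_le _).trans
      ((Finset.sum_le_sum fun p _ => hbad1 p).trans (le_of_eq ?_))
    simp only [Finset.sum_const, Finset.card_univ, Fintype.card_prod, Fintype.card_fun,
      Fintype.card_fin, nsmul_eq_mul]
    push_cast
    ring
  have hu2 : μ.real (⋃ g, bad2 g) ≤ (4 * N + 1 : ℝ) ^ (d * (r + 1)) * Real.exp (-(c * n)) := by
    refine (measureReal_iUnion_fintype_le _).trans
      ((Finset.sum_le_sum fun p _ => hbad2 p).trans ?_)
    simp only [Finset.sum_const, Finset.card_univ, Fintype.card_fun,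
      Fintype.card_fin, nsmul_eq_mul]
    push_cast
    refine mul_le_mul_of_nonneg_right (pow_le_pow_right₀ hN1 ?_) (Real.exp_nonneg _)
    exact Nat.le_mul_of_pos_right d (Nat.succ_pos r)
  refine (measureReal_mono hsub).trans ((measureReal_union_le _ _).trans ?_)
  rw [hmem]
  have := measureReal_union_le (μ := μ) (⋃ p, bad1 p) (⋃ g, bad2 g)
  linarith

end Sample

/-! ### From the grid to arbitrary vectors -/

section Perturbation

variable {k d n : ℕ} {l : Fin k → ℝ}

lemma two_abs_dotProduct_le {u e : Fin d → ℝ} {η : ℝ} (hη : 0 ≤ η) (hu : u ⬝ᵥ u ≤ 2)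
    (he : e ⬝ᵥ e ≤ η ^ 2) : |u ⬝ᵥ e| ≤ 2 * η := by
  refine abs_le_of_sq_le_sq ((dotProduct_sq_le u e).trans ?_) (by positivity)
  nlinarith [mul_le_mul hu he (dotProduct_mul_self_nonneg e) zero_le_two, sq_nonneg η]

lemma dotProduct_self_of_sub {u v : Fin d → ℝ} :
    v ⬝ᵥ v = u ⬝ᵥ u + 2 * (u ⬝ᵥ (v - u)) + (v - u) ⬝ᵥ (v - u) := by
  simp only [dotProduct_sub, sub_dotProduct, dotProduct_comm v u]
  ring

lemma dotProduct_self_le_three {u v : Fin d → ℝ} {η : ℝ} (hη : 0 ≤ η) (hη' : η ≤ 1 / 8)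
    (hu : u ⬝ᵥ u ≤ 2) (he : (v - u) ⬝ᵥ (v - u) ≤ η ^ 2) : v ⬝ᵥ v ≤ 3 := by
  rw [dotProduct_self_of_sub (u := u)]
  have := (abs_le.1 (two_abs_dotProduct_le hη hu he)).2
  nlinarith

lemma abs_form_self_sub_le (hl : ∀ i, 0 < l i) (hl1 : ∀ i, l i ≤ 1)
    {P : Matrix (Fin d) (Fin d) ℝ} (hP : P ∈ measurementSet l d) {u v : Fin d → ℝ} {η : ℝ}
    (hη : 0 ≤ η) (hu : u ⬝ᵥ u ≤ 3) (hv : v ⬝ᵥ v ≤ 3) (he : (v - u) ⬝ᵥ (v - u) ≤ η ^ 2) :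
    |form P v v - form P u u| ≤ 4 * η := by
  have h1 : form P v v - form P u u = form P (v - u) (v + u) := by
    simp only [form_sub_left, form_add_right, form_comm_of_mem hP v u]
    ring
  have h2 : (v + u) ⬝ᵥ (v + u) ≤ 16 := by
    have := dotProduct_mul_self_nonneg (v - u)
    simp only [dotProduct_sub, sub_dotProduct, dotProduct_add, add_dotProduct] at this ⊢
    linarith
  rw [h1]
  refine abs_le_of_sq_le_sq ((form_sq_le hl hl1 hP _ _).trans ?_) (by positivity)
  refine (mul_le_mul he h2 (dotProduct_mul_self_nonneg _) (sq_nonneg _)).trans (le_of_eq ?_)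
  ring

/-- Truncation is 1-Lipschitz, so grid errors enter additively. -/
lemma min_abs_le_add (a b M : ℝ) : min |b| M ≤ min |a| M + |a - b| := by
  rw [← sub_le_iff_le_add]
  refine le_min ?_ ?_
  · have h := abs_sub_abs_le_abs_sub b a
    rw [abs_sub_comm] at h
    linarith [min_le_left |b| M]
  · linarith [min_le_right |b| M, abs_nonneg (a - b)]

lemma abs_le_two_of_dotProduct_self_le {u : Fin d → ℝ} (hu : u ⬝ᵥ u ≤ 2) (i : Fin d) :
    |u i| ≤ 2 := by
  have h : u i * u i ≤ u ⬝ᵥ u :=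
    Finset.single_le_sum (f := fun i => u i * u i) (fun i _ => mul_self_nonneg _)
      (Finset.mem_univ i)
  refine abs_le_of_sq_le_sq ?_ zero_le_two
  nlinarith

variable {x : Fin d → ℝ} {r N : ℕ} {β M B K η : ℝ} {Q : Fin n → Matrix (Fin d) (Fin d) ℝ}

lemma IsGoodSample.sum_min_form_le (h : IsGoodSample l x r N β M B K Q) (hl : ∀ i, 0 < l i)
    (hl1 : ∀ i, l i ≤ 1) (hN : 0 < N) (hη : 0 ≤ η) (hη' : η ≤ 1 / 8)
    (hNη : (d : ℝ) / N ^ 2 ≤ η ^ 2) (hdη : 4 * d * η ≤ 1) {g : Fin d → ℝ} (hg : g ⬝ᵥ g ≤ 2) :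
    ∑ j, min |d * form (Q j) g g| K ≤ (2 * B + 1) * n := by
  obtain ⟨a, ha⟩ := exists_gridVec_close hN g (abs_le_two_of_dotProduct_self_le hg)
  have ha' := ha.trans hNη
  have h3 := dotProduct_self_le_three hη hη' hg ha'
  have hj : ∀ j, min |d * form (Q j) g g| K ≤ min |d * form (Q j) (gridVec a) (gridVec a)| K + 1 := by
    intro j
    refine (min_abs_le_add (d * form (Q j) (gridVec a) (gridVec a)) _ K).trans ?_
    gcongr
    rw [← mul_sub, abs_mul, Nat.abs_cast]
    refine (mul_le_mul_of_nonneg_left (abs_form_self_sub_le hl hl1 (h.mem j) hη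
      (hg.trans (by norm_num)) h3 ha') (Nat.cast_nonneg d)).trans ?_
    linarith
  refine (Finset.sum_le_sum fun j _ => hj j).trans ?_
  rw [Finset.sum_add_distrib]
  have := h.upper a h3
  simp only [Finset.sum_const, Finset.card_univ, Fintype.card_fin, nsmul_eq_mul, mul_one]
  linarith

/-- The cross term moves by at most `2η` and the average of rank-one terms by at most `4η`, whatever
`r` is. Multiplied by `d` this costs `β / 4` of the bound `β / 2` available on the grid. -/
lemma IsGoodSample.le_sum_min_descentMatrix (h : IsGoodSample l x r N β M B K Q)
    (hl : ∀ i, 0 < l i) (hl1 : ∀ i, l i ≤ 1) (hx : x ⬝ᵥ x = 1) (hr : 0 < r) (hN : 0 < N)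
    (hη : 0 ≤ η) (hη' : η ≤ 1 / 8) (hNη : (d : ℝ) / N ^ 2 ≤ η ^ 2) (hdη : 6 * d * η ≤ β / 4)
    {z : Fin d → ℝ} (hz : z ⬝ᵥ z = 1) {g : Fin r → Fin d → ℝ} (hg : ∀ a, g a ⬝ᵥ g a ≤ 2)
    (hgx : ∀ a, g a ⬝ᵥ x = 0) :
    n * (β / 4) ≤ ∑ j, min |d * hsInner (Q j) (descentMatrix x z g)| M := by
  have hz2 : z ⬝ᵥ z ≤ 2 := hz.le.trans (by norm_num)
  have hrR : (0 : ℝ) < r := by exact_mod_cast hr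
  obtain ⟨z', hz'⟩ := exists_gridVec_close hN z (abs_le_two_of_dotProduct_self_le hz2)
  replace hz' := hz'.trans hNη
  choose g' hg' using fun a => exists_gridVec_close hN (g a)
    (abs_le_two_of_dotProduct_self_le (hg a))
  replace hg' := fun a => (hg' a).trans hNη
  -- Grid points need not be orthogonal to `x`; projecting them restores this, and since `g a` is
  -- fixed by the projection, the distance to it does not increase.
  have hproj : ∀ a, projCompl x (gridVec (g' a)) - g a = projCompl x (gridVec (g' a) - g a) := by
    intro a
    simp only [projCompl, dotProduct_sub, dotProduct_comm x (g a), hgx, sub_zero]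
    abel
  have hproj' : ∀ a, (projCompl x (gridVec (g' a)) - g a) ⬝ᵥ
      (projCompl x (gridVec (g' a)) - g a) ≤ η ^ 2 := by
    intro a
    rw [hproj]
    exact (projCompl_self_le hx _).trans (hg' a)
  have hz3 : 1 / 4 ≤ gridVec z' ⬝ᵥ gridVec z' := by
    rw [dotProduct_self_of_sub (u := z), hz]
    have := (abs_le.1 (two_abs_dotProduct_le hη hz2 hz')).1
    linarith [dotProduct_mul_self_nonneg (gridVec z' - z)]
  have hlow := h.lower z' g' ((dotProduct_self_le_three hη hη' hz2 hz').trans (by norm_num)) hz3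
    fun a => dotProduct_self_le_three hη hη' (hg a) (hg' a)
  have hj : ∀ j, min |d * hsInner (Q j) (descentMatrix x (gridVec z')
      fun a => projCompl x (gridVec (g' a)))| M ≤
      min |d * hsInner (Q j) (descentMatrix x z g)| M + β / 4 := by
    intro j
    refine (min_abs_le_add (d * hsInner (Q j) (descentMatrix x z g)) _ M).trans ?_
    gcongr
    rw [← mul_sub, abs_mul, Nat.abs_cast, abs_sub_comm]
    have h1 : hsInner (Q j) (descentMatrix x (gridVec z')
        fun a => projCompl x (gridVec (g' a))) - hsInner (Q j) (descentMatrix x z g) =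
        2 * form (Q j) x (gridVec z' - z) + 1 / r * ∑ a,
          (form (Q j) (projCompl x (gridVec (g' a))) (projCompl x (gridVec (g' a))) -
            form (Q j) (g a) (g a)) := by
      rw [hsInner_descentMatrix, hsInner_descentMatrix, Finset.sum_sub_distrib, form_sub_right,
        form_comm_of_mem (h.mem j) (gridVec z') x, form_comm_of_mem (h.mem j) z x]
      ring
    have h2 : |form (Q j) x (gridVec z' - z)| ≤ η := by
      refine abs_le_of_sq_le_sq ((form_sq_le hl hl1 (h.mem j) _ _).trans ?_) hη
      rw [hx, one_mul]
      exact hz'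
    have h3 : |1 / (r : ℝ) * ∑ a,
        (form (Q j) (projCompl x (gridVec (g' a))) (projCompl x (gridVec (g' a))) -
          form (Q j) (g a) (g a))| ≤ 4 * η := by
      rw [abs_mul, abs_of_pos (one_div_pos.2 hrR)]
      have := (Finset.abs_sum_le_sum_abs (fun a => form (Q j) (projCompl x (gridVec (g' a)))
        (projCompl x (gridVec (g' a))) - form (Q j) (g a) (g a)) Finset.univ).trans
        (Finset.sum_le_sum fun a _ => abs_form_self_sub_le hl hl1 (h.mem j) hη
          ((hg a).trans (by norm_num))
          ((projCompl_self_le hx _).trans (dotProduct_self_le_three hη hη' (hg a) (hg' a)))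
          (hproj' a))
      refine (mul_le_mul_of_nonneg_left this (by positivity)).trans (le_of_eq ?_)
      simp only [Finset.sum_const, Finset.card_univ, Fintype.card_fin, nsmul_eq_mul]
      field_simp
    have h4 : |hsInner (Q j) (descentMatrix x (gridVec z')
        fun a => projCompl x (gridVec (g' a))) - hsInner (Q j) (descentMatrix x z g)| ≤ 6 * η := by
      rw [h1]
      refine (abs_add_le _ _).trans ?_
      rw [abs_mul, abs_two]
      linarith
    refine (mul_le_mul_of_nonneg_left h4 (Nat.cast_nonneg d)).trans ?_
    linarith
  have := hlow.trans_le (Finset.sum_le_sum fun j _ => hj j)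
  rw [Finset.sum_add_distrib] at this
  simp only [Finset.sum_const, Finset.card_univ, Fintype.card_fin, nsmul_eq_mul] at this
  linarith

end Perturbation

/-! ### Low-rank randomisation of a positive semidefinite matrix -/

section Signs

variable {k d n : ℕ} {l : Fin k → ℝ}

/-- The random vector `∑ i, ξ i √(w i) v i`, with `v i` the columns of `V`. -/
noncomputable def signVec (V : Matrix (Fin d) (Fin d) ℝ) (w : Fin d → ℝ) (ξ : Fin d → Bool) :
    Fin d → ℝ :=
  V *ᵥ fun i => sgn (ξ i) * √(w i)

lemma sgn_mul_self (b : Bool) : sgn b * sgn b = 1 := by cases b <;> simp [sgn]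

/-- The columns are orthonormal and the signs square to one, so the norm is the same for every
choice of signs: every realisation meets the norm constraint of the good-sample estimates. -/
lemma signVec_dotProduct_self {V : Matrix (Fin d) (Fin d) ℝ}
    (hV : V ∈ Matrix.orthogonalGroup (Fin d) ℝ) {w : Fin d → ℝ} (hw : ∀ i, 0 ≤ w i)
    (ξ : Fin d → Bool) : signVec V w ξ ⬝ᵥ signVec V w ξ = ∑ i, w i := by
  rw [signVec, mulVec_dotProduct_mulVec_of_mem hV]
  refine Finset.sum_congr rfl fun i _ => ?_
  rw [mul_mul_mul_comm, sgn_mul_self, one_mul, Real.mul_self_sqrt (hw i)]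

lemma signVec_dotProduct_eq_zero {V : Matrix (Fin d) (Fin d) ℝ} {w : Fin d → ℝ}
    (hw : ∀ i, 0 ≤ w i) {x : Fin d → ℝ} (hx : form (V * diagonal w * Vᵀ) x x = 0)
    (ξ : Fin d → Bool) : signVec V w ξ ⬝ᵥ x = 0 := by
  rw [form_conj_diagonal,
    Finset.sum_eq_zero_iff_of_nonneg fun i _ => mul_nonneg (hw i) (mul_self_nonneg _)] at hx
  rw [signVec, ← vecMul_transpose, ← dotProduct_mulVec]
  refine Finset.sum_eq_zero fun i hi => ?_
  rcases mul_eq_zero.1 (hx i hi) with h | h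
  · simp [h]
  · simp [mul_self_eq_zero.1 h]

/-- In an eigenbasis of `P` the form is a weighted sum of squares of Rademacher sums, so the general
moment bounds apply. The second moment being comparable with the squared mean, for every `P`, serves
both the upper and the lower truncated estimate below. -/
lemma expect_form_signVec {P : Matrix (Fin d) (Fin d) ℝ} (hl : ∀ i, 0 < l i)
    (hP : P ∈ measurementSet l d) (V : Matrix (Fin d) (Fin d) ℝ) {w : Fin d → ℝ}
    (hw : ∀ i, 0 ≤ w i) :
    𝔼 ξ, form P (signVec V w ξ) (signVec V w ξ) = hsInner P (V * diagonal w * Vᵀ) ∧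
    𝔼 ξ, form P (signVec V w ξ) (signVec V w ξ) ^ 2 ≤
      3 * hsInner P (V * diagonal w * Vᵀ) ^ 2 := by
  obtain ⟨U, hU, rfl⟩ := exists_of_mem_measurementSet hP
  have hform : ∀ ξ, form (U * diagonal (spectrumVec l d) * Uᵀ) (signVec V w ξ) (signVec V w ξ) =
      ∑ i, spectrumVec l d i * signSum (fun j => √(w j) * (Uᵀ * V) i j) ξ ^ 2 := by
    intro ξ
    rw [form_conj_diagonal]
    refine Finset.sum_congr rfl fun i _ => ?_
    have : (Uᵀ *ᵥ signVec V w ξ) i = signSum (fun j => √(w j) * (Uᵀ * V) i j) ξ := by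
      rw [signVec, mulVec_mulVec, mulVec, dotProduct, signSum]
      exact Finset.sum_congr rfl fun j _ => by ring
    rw [this, sq]
  have hval : hsInner (U * diagonal (spectrumVec l d) * Uᵀ) (V * diagonal w * Vᵀ) =
      ∑ i, spectrumVec l d i * ∑ j, (√(w j) * (Uᵀ * V) i j) ^ 2 := by
    rw [hsInner_conj_diagonal]
    simp_rw [form_conj_diagonal, Finset.mul_sum]
    rw [Finset.sum_comm]
    refine Finset.sum_congr rfl fun i _ => Finset.sum_congr rfl fun j _ => ?_
    have : (Uᵀ *ᵥ Vᵀ j) i = (Uᵀ * V) i j := rfl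
    rw [this, mul_pow, Real.sq_sqrt (hw j)]
    ring
  simp_rw [hform, hval]
  exact ⟨expect_weighted_sq _ _, expect_weighted_sq_sq_le _ (spectrumVec_nonneg hl) _⟩

variable {x : Fin d → ℝ} {N ρ : ℕ} {β M B η : ℝ} {Q : Fin n → Matrix (Fin d) (Fin d) ℝ}

/-- On a good sample no descent direction is invisible to all measurements. -/
lemma IsGoodSample.not_forall_hsInner_eq_zero
    (h : IsGoodSample l x (3 * ρ ^ 2) N β M B (3 / 2 * (M * ρ)) Q) (hn : 0 < n)
    (hl : ∀ i, 0 < l i) (hl1 : ∀ i, l i ≤ 1) (hx : x ⬝ᵥ x = 1) (hM : 0 < M) (hρ : 0 < ρ)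
    (hN : 0 < N) (hη : 0 ≤ η) (hη' : η ≤ 1 / 8) (hNη : (d : ℝ) / N ^ 2 ≤ η ^ 2)
    (hdη1 : 4 * d * η ≤ 1) (hdη : 6 * d * η ≤ β / 4) (hρβ : 2 * (2 * B + 1) / ρ < β / 4)
    {z : Fin d → ℝ} (hz : z ⬝ᵥ z = 1) {W : Matrix (Fin d) (Fin d) ℝ} (hW : W.PosSemidef)
    (hWx : form W x x = 0) (hWtr : W.trace ≤ 2)
    (h0 : ∀ j, form (Q j) x z + form (Q j) z x + hsInner (Q j) W = 0) : False := by
  have hWs : W.IsSymm := by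
    have := hW.1
    rwa [Matrix.IsHermitian, conjTranspose_eq_transpose_of_trivial] at this
  obtain ⟨V, hV, w, rfl⟩ := exists_orthogonal_diagonalization hWs
  have hw : ∀ i, 0 ≤ w i := by
    intro i
    have h1 := hW.dotProduct_mulVec_nonneg (V *ᵥ Pi.single i 1)
    rw [star_trivial] at h1
    change 0 ≤ form (V * diagonal w * Vᵀ) (V *ᵥ Pi.single i 1) (V *ᵥ Pi.single i 1) at h1
    rw [form_conj_diagonal, mulVec_mulVec, transpose_mul_self_of_mem hV, one_mulVec] at h1
    simpa [Pi.single_apply] using h1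
  have htr : ∑ i, w i ≤ 2 := by
    rw [trace_mul_comm, ← mul_assoc, transpose_mul_self_of_mem hV, one_mul, trace_diagonal] at hWtr
    exact hWtr
  set W := V * diagonal w * Vᵀ with hWdef
  have hρR : (0 : ℝ) < ρ := by exact_mod_cast hρ
  have hnR : (0 : ℝ) < n := by exact_mod_cast hn
  have hdR : (0 : ℝ) ≤ d := Nat.cast_nonneg d
  set f : Fin n → ℝ := fun j => hsInner (Q j) W with hf
  have hE := fun j => expect_form_signVec hl (h.mem j) V hw
  have hqnn : ∀ j ξ, 0 ≤ d * form (Q j) (signVec V w ξ) (signVec V w ξ) := fun j ξ =>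
    mul_nonneg hdR (form_self_nonneg hl (h.mem j) _)
  have hf0 : ∀ j, 0 ≤ f j := by
    intro j
    rw [hf]
    simp only
    rw [← (hE j).1]
    exact Finset.expect_nonneg fun ξ _ => form_self_nonneg hl (h.mem j) _
  have hself : ∀ ξ, signVec V w ξ ⬝ᵥ signVec V w ξ ≤ 2 := fun ξ =>
    (signVec_dotProduct_self hV hw ξ).le.trans htr
  -- upper bound for the truncated linear statistics of `W`
  have hup : ∑ j, min (d * f j) (M * ρ) ≤ 2 * ((2 * B + 1) * n) := by
    have h1 : ∀ j, 1 / 2 * min (d * f j) (M * ρ) ≤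
        𝔼 ξ, min |d * form (Q j) (signVec V w ξ) (signVec V w ξ)| (3 / 2 * (M * ρ)) := by
      intro j
      simp_rw [fun ξ => abs_of_nonneg (hqnn j ξ)]
      refine half_min_le_expect_min _ (hqnn j) (by positivity) ?_ ?_
      · rw [← Finset.mul_expect, (hE j).1]
      · simp_rw [mul_pow]
        rw [← Finset.mul_expect]
        refine (mul_le_mul_of_nonneg_left (hE j).2 (sq_nonneg _)).trans (le_of_eq ?_)
        ring
    have h2 := Finset.sum_le_sum fun j (_ : j ∈ Finset.univ) => h1 j
    rw [← Finset.mul_sum, ← Finset.expect_sum_comm] at h2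
    have h3 := h2.trans (Finset.expect_le Finset.univ_nonempty fun ξ _ =>
      h.sum_min_form_le hl hl1 hN hη hη' hNη hdη1 (hself ξ))
    linarith
  -- lower bound from the random low-rank approximations of `W`
  have hlow : n * (β / 4) ≤ 1 / ρ * ∑ j, min (d * f j) (M * ρ) := by
    have h1 : ∀ ω : Fin (3 * ρ ^ 2) → Fin d → Bool, n * (β / 4) ≤ ∑ j, min
        |d * hsInner (Q j) (descentMatrix x z fun a => signVec V w (ω a))| M := fun ω =>
      h.le_sum_min_descentMatrix hl hl1 hx (by positivity) hN hη hη' hNη hdη hz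
        (fun a => hself _) (fun a => signVec_dotProduct_eq_zero hw hWx _)
    have h2 : n * (β / 4) ≤ 𝔼 ω : Fin (3 * ρ ^ 2) → Fin d → Bool, ∑ j, min
        |d * hsInner (Q j) (descentMatrix x z fun a => signVec V w (ω a))| M :=
      Finset.le_expect Finset.univ_nonempty fun ω _ => h1 ω
    rw [Finset.expect_sum_comm] at h2
    refine h2.trans ?_
    rw [Finset.mul_sum]
    refine Finset.sum_le_sum fun j _ => ?_
    -- By `h0` the cross terms equal `-f j`, so only centred fluctuations of the rank-one terms
    -- remain.
    have h3 : ∀ ω : Fin (3 * ρ ^ 2) → Fin d → Bool,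
        d * hsInner (Q j) (descentMatrix x z fun a => signVec V w (ω a)) =
        d / (3 * ρ ^ 2) * ∑ a, (form (Q j) (signVec V w (ω a)) (signVec V w (ω a)) - f j) := by
      intro ω
      rw [hsInner_descentMatrix, Finset.sum_sub_distrib]
      simp only [Finset.sum_const, Finset.card_univ, Fintype.card_fin, nsmul_eq_mul]
      have h4 : form (Q j) x z + form (Q j) z x = - f j := by linarith [h0 j]
      rw [h4]
      push_cast
      field_simp
      ring
    -- Each term has variance at most `3 * f j ^ 2`; averaging `3 * ρ ^ 2` independent copies leaves
    -- `f j ^ 2 / ρ ^ 2`, which explains the number of copies.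
    have h5 : 𝔼 ω : Fin (3 * ρ ^ 2) → Fin d → Bool,
        (d * hsInner (Q j) (descentMatrix x z fun a => signVec V w (ω a))) ^ 2 ≤
          (d * f j / ρ) ^ 2 := by
      simp_rw [h3, mul_pow]
      rw [← Finset.mul_expect, expect_sum_sq (fun ξ : Fin d → Bool =>
        form (Q j) (signVec V w ξ) (signVec V w ξ) - f j)
        (by rw [Finset.expect_sub_distrib, (hE j).1, Fintype.expect_const, sub_self])]
      have h6 : 𝔼 ξ : Fin d → Bool, (form (Q j) (signVec V w ξ) (signVec V w ξ) - f j) ^ 2 ≤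
          3 * f j ^ 2 := by
        have h7 : ∀ ξ : Fin d → Bool, (form (Q j) (signVec V w ξ) (signVec V w ξ) - f j) ^ 2 =
            form (Q j) (signVec V w ξ) (signVec V w ξ) ^ 2 -
              2 * f j * form (Q j) (signVec V w ξ) (signVec V w ξ) + f j ^ 2 := fun ξ => by ring
        simp_rw [h7]
        rw [Finset.expect_add_distrib, Finset.expect_sub_distrib, ← Finset.mul_expect, (hE j).1,
          Fintype.expect_const]
        have := (hE j).2
        have hff : hsInner (Q j) W = f j := rfl
        rw [hff] at this ⊢
        nlinarith [sq_nonneg (f j)]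
      refine (mul_le_mul_of_nonneg_left (mul_le_mul_of_nonneg_left h6 (Nat.cast_nonneg _))
        (sq_nonneg _)).trans (le_of_eq ?_)
      push_cast
      field_simp
    refine (expect_min_abs_le _ (div_nonneg (mul_nonneg hdR (hf0 j)) hρR.le) h5).trans
      (le_of_eq ?_)
    rw [mul_min_of_nonneg _ _ (by positivity)]
    congr 1
    · ring
    · field_simp
  have h8 := hlow.trans (mul_le_mul_of_nonneg_left hup (show 0 ≤ 1 / (ρ : ℝ) by positivity))
  have h9 : 1 / (ρ : ℝ) * (2 * ((2 * B + 1) * n)) = n * (2 * (2 * B + 1) / ρ) := by ring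
  rw [h9] at h8
  exact absurd (le_of_mul_le_mul_left h8 hnR) (not_le.2 hρβ)

end Signs

/-! ### Descent decomposition and numerical constants -/

section Uniqueness

variable {k d n : ℕ} {l : Fin k → ℝ} {e : Fin d → ℝ} {N ρ : ℕ} {β M B η : ℝ}
  {Q : Fin n → Matrix (Fin d) (Fin d) ℝ}

lemma form_vecMulVec (a b u v : Fin d → ℝ) :
    form (vecMulVec a b) u v = (u ⬝ᵥ a) * (b ⬝ᵥ v) := by
  simp [form, vecMulVec_mulVec, mul_comm]

lemma form_sub_matrix (X Y : Matrix (Fin d) (Fin d) ℝ) (u v : Fin d → ℝ) :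
    form (X - Y) u v = form X u v - form Y u v := by
  simp [form, sub_mulVec, dotProduct_sub]

lemma form_smul_matrix (c : ℝ) (X : Matrix (Fin d) (Fin d) ℝ) (u v : Fin d → ℝ) :
    form (c • X) u v = c * form X u v := by
  simp [form, smul_mulVec]

lemma form_comm_of_isSymm {X : Matrix (Fin d) (Fin d) ℝ} (hX : X.IsSymm) (u v : Fin d → ℝ) :
    form X u v = form X v u := by
  rw [form, dotProduct_mulVec, ← mulVec_transpose, hX.eq, dotProduct_comm, form]

/-- Positivity of `X` makes the part of the difference orthogonal to `e` positive semidefinite, and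
the trace constraint bounds its trace by the size of the cross term `z`. After normalising `z`, a
nonzero difference would be an invisible descent direction. -/
lemma IsGoodSample.eq_of_posSemidef
    (h : IsGoodSample l e (3 * ρ ^ 2) N β M B (3 / 2 * (M * ρ)) Q) (hn : 0 < n)
    (hl : ∀ i, 0 < l i) (hl1 : ∀ i, l i ≤ 1) (he : e ⬝ᵥ e = 1) (hM : 0 < M) (hρ : 0 < ρ)
    (hN : 0 < N) (hη : 0 ≤ η) (hη' : η ≤ 1 / 8) (hNη : (d : ℝ) / N ^ 2 ≤ η ^ 2)
    (hdη1 : 4 * d * η ≤ 1) (hdη : 6 * d * η ≤ β / 4) (hρβ : 2 * (2 * B + 1) / ρ < β / 4)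
    {X : Matrix (Fin d) (Fin d) ℝ} (hX : X.PosSemidef) {s : ℝ} (htr : X.trace = s)
    (hQ : ∀ j, hsInner (Q j) X = hsInner (Q j) (s • vecMulVec e e)) :
    X = s • vecMulVec e e := by
  have hXs : X.IsSymm := by
    have := hX.1
    rwa [Matrix.IsHermitian, conjTranspose_eq_transpose_of_trivial] at this
  set Δ := X - s • vecMulVec e e with hΔ
  have hΔs : Δ.IsSymm := hXs.sub ((isSymm_vecMulVec e).smul s)
  set a := form Δ e e with ha
  -- Half of the `e`-component is removed because it is counted in both `e z*` and `z e*`; with this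
  -- choice the two terms reproduce `Δ e`.
  set z := Δ *ᵥ e - (a / 2) • e with hz
  set W := Δ - vecMulVec e z - vecMulVec z e with hW
  have hΔW : Δ = W + vecMulVec e z + vecMulVec z e := by rw [hW]; abel
  -- The compression annihilates `s • vecMulVec e e`, so only `X` contributes.
  have hformW : ∀ v, form W v v = form X (projCompl e v) (projCompl e v) := by
    intro v
    have h1 : z ⬝ᵥ v = form X v e - s * (e ⬝ᵥ v) - (form X e e - s) / 2 * (e ⬝ᵥ v) := by
      rw [hz, sub_dotProduct, smul_dotProduct, smul_eq_mul, dotProduct_comm, ha]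
      change form Δ v e - _ = _
      simp only [hΔ, form_sub_matrix, form_smul_matrix, form_vecMulVec, he, dotProduct_comm v e]
      ring
    simp only [hW, hΔ, form_sub_matrix, form_smul_matrix, form_vecMulVec, projCompl, form_sub_left,
      form_sub_right, form_smul_left, form_smul_right, dotProduct_comm v z, h1,
      dotProduct_comm v e, form_comm_of_isSymm hXs e v]
    ring
  have hWpsd : W.PosSemidef := by
    refine PosSemidef.of_dotProduct_mulVec_nonneg ?_ fun v => ?_
    · rw [Matrix.IsHermitian, conjTranspose_eq_transpose_of_trivial, hW, transpose_sub,
        transpose_sub, transpose_vecMulVec, transpose_vecMulVec, hΔs.eq]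
      abel
    · rw [star_trivial]
      change 0 ≤ form W v v
      rw [hformW]
      have := hX.dotProduct_mulVec_nonneg (projCompl e v)
      rwa [star_trivial] at this
  have hWe : form W e e = 0 := by
    rw [hformW]
    simp [projCompl, he, form]
  have hWtr : W.trace = -2 * (e ⬝ᵥ z) := by
    simp only [hW, hΔ, trace_sub, trace_smul, trace_vecMulVec, htr, he, smul_eq_mul,
      dotProduct_comm z e]
    ring
  suffices hΔ0 : Δ = 0 from sub_eq_zero.1 hΔ0
  rcases eq_or_ne z 0 with hz0 | hz0
  · have : W = 0 := hWpsd.trace_eq_zero_iff.1 (by rw [hWtr, hz0]; simp)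
    rw [hΔW, this, hz0]
    simp
  exfalso
  have hzz : 0 < z ⬝ᵥ z := lt_of_le_of_ne (dotProduct_mul_self_nonneg z)
    fun h0 => hz0 (dotProduct_self_eq_zero.1 h0.symm)
  set τ := √(z ⬝ᵥ z) with hτ
  have hτ0 : 0 < τ := Real.sqrt_pos.2 hzz
  have hτsq : τ ^ 2 = z ⬝ᵥ z := Real.sq_sqrt hzz.le
  refine h.not_forall_hsInner_eq_zero hn hl hl1 he hM hρ hN hη hη' hNη hdη1 hdη hρβ
    (z := τ⁻¹ • z) (W := τ⁻¹ • W) ?_ (hWpsd.smul (inv_nonneg.2 hτ0.le)) ?_ ?_ ?_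
  · rw [smul_dotProduct, dotProduct_smul, ← hτsq, smul_eq_mul, smul_eq_mul]
    field_simp
  · rw [form_smul_matrix, hWe, mul_zero]
  · rw [trace_smul, hWtr, smul_eq_mul, inv_mul_le_iff₀ hτ0]
    have h1 : |e ⬝ᵥ z| ≤ τ := by
      refine abs_le_of_sq_le_sq ((dotProduct_sq_le e z).trans (le_of_eq ?_)) hτ0.le
      rw [he, one_mul, hτsq]
    linarith [(abs_le.1 h1).1]
  · intro j
    have h1 : hsInner (Q j) Δ = 0 := by rw [hΔ, hsInner_sub_right, hQ, sub_self]
    rw [hΔW, hsInner_add_right, hsInner_add_right, hsInner_vecMulVec, hsInner_vecMulVec] at h1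
    rw [form_smul_left, form_smul_right, hsInner_smul_right, ← mul_add, ← mul_add]
    rw [show form (Q j) e z + form (Q j) z e + hsInner (Q j) W = 0 by linarith, mul_zero]

lemma trace_rankOne (x : EuclideanSpace ℝ (Fin d)) : (rankOne x).trace = ‖x‖ ^ 2 := by
  rw [rankOne, trace_vecMulVec, EuclideanSpace.real_norm_sq_eq]
  simp [dotProduct, sq]

lemma isFeasible_rankOne (x : EuclideanSpace ℝ (Fin d)) (Q : Fin n → Matrix (Fin d) (Fin d) ℝ) :
    IsFeasible x Q (rankOne x) where
  posSemidef := by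
    have := posSemidef_vecMulVec_self_star x.ofLp
    rwa [star_trivial] at this
  norm_known := by rw [hsInner_one_right, trace_rankOne]
  measurement := fun _ => rfl

lemma isUniqueSolution_rankOne_zero (Q : Fin n → Matrix (Fin d) (Fin d) ℝ) :
    IsUniqueSolution (0 : EuclideanSpace ℝ (Fin d)) Q (rankOne 0) := by
  refine ⟨isFeasible_rankOne 0 Q, fun Y hY => ?_⟩
  have h := hY.norm_known
  rw [hsInner_one_right, norm_zero, zero_pow two_ne_zero] at h
  rw [hY.posSemidef.trace_eq_zero_iff.1 h]
  simp [rankOne]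

lemma rankOne_eq_smul {x : EuclideanSpace ℝ (Fin d)} (hx : x ≠ 0) :
    rankOne x = ‖x‖ ^ 2 • vecMulVec (‖x‖⁻¹ • x.ofLp) (‖x‖⁻¹ • x.ofLp) := by
  have : ‖x‖ ≠ 0 := norm_ne_zero_iff.2 hx
  rw [rankOne, vecMulVec_smul, smul_vecMulVec, smul_smul, smul_smul,
    show ‖x‖ ^ 2 * ‖x‖⁻¹ * ‖x‖⁻¹ = 1 by field_simp, one_smul]

lemma unit_dotProduct_self {x : EuclideanSpace ℝ (Fin d)} (hx : x ≠ 0) :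
    (‖x‖⁻¹ • x.ofLp) ⬝ᵥ (‖x‖⁻¹ • x.ofLp) = 1 := by
  have : ‖x‖ ≠ 0 := norm_ne_zero_iff.2 hx
  have h := trace_rankOne x
  rw [rankOne, trace_vecMulVec] at h
  rw [smul_dotProduct, dotProduct_smul, h, smul_eq_mul, smul_eq_mul]
  field_simp

/-- The sample size absorbs the entropy of the grid. -/
lemma failure_le_exp {k d t n p r : ℕ} {C c A ω : ℝ} (hk : 1 ≤ k) (hkd : k < d) (ht : 3 ≤ t)
    (hω : 1 ≤ ω) (hc : 0 < c) (hCp : 5 * C ≤ 2 ^ p) (hC1 : 1 ≤ C)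
    (hA : A = (p + 2) * (r + 1))
    (hn : 2 * (A + 2) / c * ω * t * (d : ℝ) ^ (1 + 2 / (t : ℝ)) * Real.log d ^ 2 ≤ n) :
    0 < n ∧ 2 * (4 * (C * d ^ 2) + 1) ^ (d * (r + 1)) * Real.exp (-(c * n)) ≤ Real.exp (-ω) := by
  have hd2 : (2 : ℝ) ≤ d := by exact_mod_cast (show 2 ≤ d by omega)
  have hd0 : (0 : ℝ) < d := by linarith
  have ht3 : (3 : ℝ) ≤ t := by exact_mod_cast ht
  have hlog : 0.69 ≤ Real.log d := by
    have := Real.log_le_log (by norm_num) hd2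
    linarith [Real.log_two_gt_d9]
  have hlog0 : 0 < Real.log d := by linarith
  have hA0 : 0 ≤ A := by rw [hA]; positivity
  set D := d * Real.log d with hD
  have hD1 : 1 ≤ D := by nlinarith
  have hpow : (d : ℝ) ≤ (d : ℝ) ^ (1 + 2 / (t : ℝ)) := by
    have h0 : (0 : ℝ) ≤ 2 / t := by positivity
    calc (d : ℝ) = (d : ℝ) ^ (1 : ℝ) := (Real.rpow_one _).symm
      _ ≤ _ := Real.rpow_le_rpow_of_exponent_le (by linarith) (by linarith)
  have hn' : 2 * (A + 2) / c * (ω * D) ≤ n := by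
    refine le_trans ?_ hn
    -- Sample size of order `ω d log d` is enough here; the surplus factor satisfies `t * log d ≥
    -- 1`.
    have h1 : D ≤ t * (d : ℝ) ^ (1 + 2 / (t : ℝ)) * Real.log d ^ 2 := by
      have h2 : (d : ℝ) * Real.log d * 1 ≤
          (d : ℝ) ^ (1 + 2 / (t : ℝ)) * Real.log d * (t * Real.log d) :=
        mul_le_mul (mul_le_mul_of_nonneg_right hpow hlog0.le) (by nlinarith) zero_le_one
          (by positivity)
      calc D = (d : ℝ) * Real.log d * 1 := by rw [hD, mul_one]
        _ ≤ _ := h2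
        _ = _ := by ring
    have h3 : 0 ≤ 2 * (A + 2) / c * ω := by positivity
    have h4 := mul_le_mul_of_nonneg_left h1 h3
    calc _ = 2 * (A + 2) / c * ω * D := by ring
      _ ≤ _ := h4
      _ = _ := by ring
  have hcn : 2 * (A + 2) * (ω * D) ≤ c * n := by
    have := mul_le_mul_of_nonneg_left hn' hc.le
    refine le_trans (le_of_eq ?_) this
    field_simp
  have hωD : ω ≤ ω * D := le_mul_of_one_le_right (by linarith) hD1
  have hDω : D ≤ ω * D := le_mul_of_one_le_left (by linarith) hω
  have hexpo : 1 + A * D - c * n ≤ -ω := by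
    have := mul_le_mul_of_nonneg_left hDω hA0
    nlinarith
  refine ⟨?_, ?_⟩
  · have : (0 : ℝ) < n := by
      refine lt_of_lt_of_le ?_ hn'
      have : 0 < ω * D := by linarith
      positivity
    exact_mod_cast this
  -- `4Cd² + 1 ≤ 5Cd² ≤ 2^p d² ≤ d^(p+2)`, using `d ≥ 2`.
  have hbase : 4 * (C * d ^ 2) + 1 ≤ Real.exp ((p + 2) * Real.log d) := by
    have h1 : Real.exp ((p + 2) * Real.log d) = (d : ℝ) ^ (p + 2) := by
      rw [← Real.exp_log (pow_pos hd0 (p + 2)), Real.log_pow]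
      push_cast
      rfl
    rw [h1, pow_add]
    have h2 : (2 : ℝ) ^ p ≤ (d : ℝ) ^ p := pow_le_pow_left₀ (by norm_num) hd2 p
    have h3 := mul_le_mul_of_nonneg_right (hCp.trans h2) (sq_nonneg (d : ℝ))
    nlinarith [mul_le_mul hC1 (show (1 : ℝ) ≤ d ^ 2 by nlinarith) zero_le_one (by linarith)]
  have hpow2 : (4 * (C * d ^ 2) + 1) ^ (d * (r + 1)) ≤ Real.exp (A * D) := by
    refine (pow_le_pow_left₀ (by positivity) hbase _).trans (le_of_eq ?_)
    rw [← Real.exp_nat_mul]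
    congr 1
    rw [hA, hD]
    push_cast
    ring
  have h2e : (2 : ℝ) ≤ Real.exp 1 := by linarith [Real.add_one_le_exp (1 : ℝ)]
  calc 2 * (4 * (C * d ^ 2) + 1) ^ (d * (r + 1)) * Real.exp (-(c * n))
      ≤ Real.exp 1 * Real.exp (A * D) * Real.exp (-(c * n)) := by gcongr
    _ = Real.exp (1 + A * D - c * n) := by
        rw [← Real.exp_add, ← Real.exp_add, sub_eq_add_neg]
    _ ≤ _ := Real.exp_le_exp.2 hexpo

/-- The numerical conditions on a grid of mesh `(C d²)⁻¹`. -/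
lemma grid_mesh_bounds {C d β : ℝ} (hd : 1 ≤ d) (hC : 8 ≤ C) (hβ : 24 ≤ β * C) :
    1 / (C * d) ≤ 1 / 8 ∧ d / (C * d ^ 2) ^ 2 ≤ (1 / (C * d)) ^ 2 ∧
      4 * d * (1 / (C * d)) ≤ 1 ∧ 6 * d * (1 / (C * d)) ≤ β / 4 := by
  have hd0 : 0 < d := by linarith
  have hC0 : 0 < C := by linarith
  have e1 : 4 * d * (1 / (C * d)) = 4 / C := by field_simp
  have e2 : 6 * d * (1 / (C * d)) = 6 / C := by field_simp
  have e3 : d / (C * d ^ 2) ^ 2 = 1 / (C ^ 2 * d ^ 3) := by field_simp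
  rw [e1, e2, e3, div_pow, one_pow, mul_pow]
  refine ⟨one_div_le_one_div_of_le (by norm_num) (by nlinarith),
    one_div_le_one_div_of_le (by positivity)
      (mul_le_mul_of_nonneg_left (pow_le_pow_right₀ hd (by norm_num)) (by positivity)), ?_, ?_⟩
  · rw [div_le_one hC0]
    linarith
  · rw [div_le_iff₀ hC0]
    linarith

end Uniqueness

end PhaseRetrieval

/-! ### The theorem: choice of constants and conclusion -/

theorem theorem5p4
    (k : ℕ) (hk : 1 ≤ k) (l : Fin k → ℝ)
    (hl_anti : Antitone l) (hl_pos : ∀ i, 0 < l i) (hl_le : ∀ i, l i ≤ 1) :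
    ∃ c₁ : ℝ, 0 < c₁ ∧
      ∀ (d : ℕ), k < d →
      ∀ (x : EuclideanSpace ℝ (Fin d)) (t : ℕ), 3 ≤ t →
      ∀ (Ω₀ : Type*) [MeasurableSpace Ω₀] (μ₀ : Measure Ω₀) [IsProbabilityMeasure μ₀]
        (P₀ : Ω₀ → Matrix (Fin d) (Fin d) ℝ),
        PhaseRetrieval.IsRandomCubature l 3 μ₀ P₀ →
        PhaseRetrieval.IsRandomTightFusionFrame l t μ₀ P₀ →
      ∀ (ω : ℝ), 1 ≤ ω →
      ∀ (n : ℕ), c₁ * ω * t * (d : ℝ) ^ (1 + 2 / (t : ℝ)) * Real.log d ^ 2 ≤ n →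
      ∀ (Ω : Type*) [MeasurableSpace Ω] (μ : Measure Ω) [IsProbabilityMeasure μ]
        (P : Fin n → Ω → Matrix (Fin d) (Fin d) ℝ),
        iIndepFun P μ → (∀ j, IdentDistrib (P j) P₀ μ μ₀) →
        1 - Real.exp (-ω) ≤
          μ.real {s | PhaseRetrieval.IsUniqueSolution x (fun j => P j s)
            (PhaseRetrieval.rankOne x)} := by
  have hkR : (0 : ℝ) < k := by exact_mod_cast hk
  have hne : (Finset.univ : Finset (Fin k)).Nonempty := ⟨⟨0, hk⟩, Finset.mem_univ _⟩
  have hL : 0 < ∑ i, l i := Finset.sum_pos (fun i _ => hl_pos i) hne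
  have hL2 : 0 < ∑ i, l i ^ 2 := Finset.sum_pos (fun i _ => pow_pos (hl_pos i) 2) hne
  obtain ⟨κ, hκ⟩ : ∃ κ : ℝ, κ = (∑ i, l i ^ 2) / k := ⟨_, rfl⟩
  have hκ0 : 0 < κ := hκ ▸ div_pos hL2 hkR
  obtain ⟨M, hM⟩ : ∃ M : ℝ, M = 8 * (12420 * (∑ i, l i) ^ 3) / κ := ⟨_, rfl⟩
  have hM0 : 0 < M := hM ▸ by positivity
  obtain ⟨β, hβ⟩ : ∃ β : ℝ, β = κ / (8 * M) := ⟨_, rfl⟩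
  have hβ0 : 0 < β := hβ ▸ by positivity
  obtain ⟨B, hB⟩ : ∃ B : ℝ, B = 1 + 405 * (∑ i, l i) ^ 3 := ⟨_, rfl⟩
  have hB0 : 0 < B := hB ▸ by positivity
  -- `ρ` is fixed before `d`, so the rank `3 * ρ ^ 2` of the approximations, the truncation level `3
  -- / 2 * (M * ρ)` and the Hoeffding rate `c` depend only on the spectrum.
  obtain ⟨ρ, hρ⟩ := exists_nat_gt (2 * (2 * B + 1) / (β / 4))
  have hρR : (0 : ℝ) < ρ := lt_of_le_of_lt (by positivity) hρ
  have hρ0 : 0 < ρ := by exact_mod_cast hρR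
  have hρβ : 2 * (2 * B + 1) / ρ < β / 4 := by
    rw [div_lt_iff₀ (by positivity)] at hρ ⊢
    linarith
  have hK0 : 0 < 3 / 2 * (M * ρ) := by positivity
  obtain ⟨c, hc⟩ : ∃ c : ℝ, c = min (2 * (β / 2) ^ 2 / M ^ 2) (2 * B ^ 2 / (3 / 2 * (M * ρ)) ^ 2) :=
    ⟨_, rfl⟩
  have hc0 : 0 < c := hc ▸ lt_min (by positivity) (by positivity)
  -- The grid has mesh `1 / (C d²)` and precision `η = 1 / (C d)`; this lower bound on `C` makes the
  -- total perturbation, after multiplication by `d`, at most `1` and at most `β / 4`.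
  obtain ⟨C, hC⟩ := exists_nat_ge (max (24 / β) 8)
  have hC8 : (8 : ℝ) ≤ C := (le_max_right _ _).trans hC
  have hCβ : 24 / β ≤ C := (le_max_left _ _).trans hC
  obtain ⟨p, hp⟩ := pow_unbounded_of_one_lt (5 * (C : ℝ)) one_lt_two
  refine ⟨2 * (((p + 2) * ((3 * ρ ^ 2 : ℕ) + 1)) + 2) / c, by positivity, ?_⟩
  intro d hkd x t ht Ω₀ _ μ₀ _ P₀ h3 _ ω hω n hn Ω _ μ _ P hind hid
  obtain ⟨hn0, hfail⟩ := PhaseRetrieval.failure_le_exp hk hkd ht hω hc0 hp.le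
    (by linarith) rfl hn
  -- The zero signal cannot be normalised, but there trace zero and positivity already force the
  -- solution.
  rcases eq_or_ne x 0 with rfl | hx
  · have : {s | PhaseRetrieval.IsUniqueSolution (0 : EuclideanSpace ℝ (Fin d)) (fun j => P j s)
        (PhaseRetrieval.rankOne 0)} = Set.univ :=
      Set.eq_univ_of_forall fun s => PhaseRetrieval.isUniqueSolution_rankOne_zero _
    rw [this, probReal_univ]
    linarith [Real.exp_nonneg (-ω)]
  have hd0 : (0 : ℝ) < d := by exact_mod_cast (Nat.zero_le k).trans_lt hkd
  have hd1 : (1 : ℝ) ≤ d := by exact_mod_cast (show 1 ≤ d by omega)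
  have hC0 : (0 : ℝ) < C := by linarith
  have hgood := PhaseRetrieval.measure_not_isGoodSample_le (N := C * d ^ 2) (r := 3 * ρ ^ 2)
    (c := c) hk hkd hl_pos h3 hind hid (PhaseRetrieval.unit_dotProduct_self hx) (by positivity)
    hκ hM hβ hB hK0 (hc ▸ min_le_left _ _) (hc ▸ min_le_right _ _)
  push_cast at hgood hfail
  have hbad := hgood.trans hfail
  set e := ‖x‖⁻¹ • x.ofLp with he
  obtain ⟨hη8, hNη, hdη1, hdη⟩ := PhaseRetrieval.grid_mesh_bounds (β := β) hd1 hC8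
    (by rw [div_le_iff₀ hβ0] at hCβ; linarith)
  have hsub : (Set.univ : Set Ω) ⊆ {s | PhaseRetrieval.IsUniqueSolution x (fun j => P j s)
      (PhaseRetrieval.rankOne x)} ∪ {s | ¬ PhaseRetrieval.IsGoodSample l e (3 * ρ ^ 2) (C * d ^ 2)
        β M B (3 / 2 * (M * ρ)) fun j => P j s} := by
    intro s _
    by_cases hs : PhaseRetrieval.IsGoodSample l e (3 * ρ ^ 2) (C * d ^ 2)
        β M B (3 / 2 * (M * ρ)) fun j => P j s
    · refine Or.inl ⟨PhaseRetrieval.isFeasible_rankOne x _, fun Y hY => ?_⟩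
      rw [PhaseRetrieval.rankOne_eq_smul hx]
      refine hs.eq_of_posSemidef (η := 1 / (C * d)) hn0 hl_pos hl_le
        (PhaseRetrieval.unit_dotProduct_self hx) hM0 hρ0
        (Nat.mul_pos (by exact_mod_cast hC0) (pow_pos (by exact_mod_cast hd0) 2))
        (by positivity) hη8 (by exact_mod_cast hNη) hdη1 hdη hρβ hY.posSemidef ?_ ?_
      · rw [← PhaseRetrieval.hsInner_one_right, hY.norm_known]
      · intro j
        rw [← PhaseRetrieval.rankOne_eq_smul hx, PhaseRetrieval.hsInner_comm, hY.measurement,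
          PhaseRetrieval.hsInner_comm]
    · exact Or.inr hs
  have h1 := (measureReal_mono hsub (measure_ne_top μ _)).trans (measureReal_union_le _ _)
  rw [probReal_univ] at h1
  linarith
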